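/- Let $u,v,w\in\mathbb{C}$ be distinct and nonzero. Let $C$ be the bielliptic curve of genus $2$ over $\mathbb{C}$ that is the smooth projective model of $y^2=(x^2-u)(x^2-v)(x^2-w)$, and let $E$ and $E'$ be the smooth projective models of $y^2=(x-u)(x-v)(x-w)$ and $y^2=x(x-u)(x-v)(x-w)$; these are the quotients of $C$ by the involutions $(x,y)\mapsto(-x,y)$ and $(x,y)\mapsto(-x,-y)$, via $\psi(x,y)=(x^2,y)$ and $\psi'(x,y)=(x^2,xy)$. Let $\pi\colon E\to\mathbb{P}^1$ and $\pi'\colon E'\to\mathbb{P}^1$ be the $x$-coordinate maps, and make $E$ and $E'$ elliptic curves by choosing as origin of each an arbitrary ramification point of $\pi$, respectively $\pi'$. Put \[ I(\pi,\pi')=\pi(E_{\mathrm{tors}})\cap\pi'(E'_{\mathrm{tors}})\subset\mathbb{P}^1, \] and let $\rho=\pi\circ\psi=\pi'\circ\psi'\colon C\to\mathbb{P}^1$, so $\rho(x,y)=x^2$. A torsion packet on $C$ is a maximal subset $T\subset C$ such that for all $P,Q\in T$ the class of $P-Q$ in the Jacobian of $C$ has finite order; the hyperelliptic torsion packet is the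 torsion packet that contains the six ramification points of the hyperelliptic double cover $C\to\mathbb{P}^1$, $(x,y)\mapsto x$. Then the hyperelliptic torsion packet of $C$ exists, is unique, and equals the full preimage $\rho^{-1}(I(\pi,\pi'))$. Its size is \[ 4\,\#I(\pi,\pi')-6-2\,\#\bigl(I(\pi,\pi')\cap\{0,\infty\}\bigr), \] as an equality of cardinalities in $\mathbb{N}\cup\{\infty\}$. -/

import Mathlib

open Polynomial

noncomputable section

namespace DoubleCover

/-- The points of the smooth projective model of `y² = f(x)` over `ℂ`, for `f` squarefree of degree
`2g+1` or `2g+2`. With `z = 1/x` and `t = y/x^(g+1)` the curve is `t² = f.coeff (2g+2) + ⋯` near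
`x = ∞`; the point `infty b` is the one with `z = 0`, `t = b`. So there is one point at infinity
(`b = 0`) if `deg f = 2g+1`, and there are two if `deg f = 2g+2`. -/
inductive Point (f : ℂ[X]) (g : ℕ) : Type
  | affine (a b : ℂ) (h : b ^ 2 = f.eval a) : Point f g
  | infty (b : ℂ) (h : b ^ 2 = f.coeff (2 * g + 2)) : Point f g

/-- The function field `ℂ(x)(y)`, `y² = f(x)`; here `y` is `QuadraticAlgebra.omega`. -/
abbrev FunField (f : ℂ[X]) : Type :=
  QuadraticAlgebra (RatFunc ℂ) (algebraMap ℂ[X] (RatFunc ℂ) f) 0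

namespace Point

variable {f : ℂ[X]} {g : ℕ}

/-- The double cover given by the `x`-coordinate; `OnePoint ℂ` is the projective line. -/
def xMap : Point f g → OnePoint ℂ
  | affine a _ _ => (a : OnePoint ℂ)
  | infty _ _ => OnePoint.infty

/-- The involution `y ↦ -y` belonging to the double cover `xMap`. -/
def invol : Point f g → Point f g
  | affine a b h => affine a (-b) (by rw [neg_sq, h])
  | infty b h => infty (-b) (by rw [neg_sq, h])

/-- The ramification points of the double cover `xMap`, i.e. the fixed points of `invol`. -/
def ramification (f : ℂ[X]) (g : ℕ) : Set (Point f g) := {P | P.invol = P}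

/-- Coordinate functions of the affine chart used at `P`: `(x, y)` at an affine point,
`(1/x, y/x^(g+1))` at a point at infinity. -/
def chartFun : Point f g → Fin 2 → FunField f
  | affine _ _ _ => ![algebraMap (RatFunc ℂ) _ RatFunc.X, QuadraticAlgebra.omega]
  | infty _ _ => ![algebraMap (RatFunc ℂ) _ (RatFunc.X)⁻¹,
      algebraMap (RatFunc ℂ) _ ((RatFunc.X)⁻¹ ^ (g + 1)) * QuadraticAlgebra.omega]

/-- The coordinates of `P` in its chart. -/
def chartVal : Point f g → Fin 2 → ℂ
  | affine a b _ => ![a, b]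
  | infty b _ => ![0, b]

/-- A uniformizer at `P`: if the chart coordinates are `(s, t)`, the curve is locally `t² = h(s)`
with `h` squarefree, so `s - s(P)` is a uniformizer if `t(P) ≠ 0`, and `t` is one if `t(P) = 0`. -/
def unif (P : Point f g) : FunField f :=
  open Classical in
  if P.chartVal 1 = 0 then P.chartFun 1
  else P.chartFun 0 - algebraMap ℂ (FunField f) (P.chartVal 0)

/-- `φ` has order `k` at `P`: `φ = τ^k · p/q` with `τ` the uniformizer and `p`, `q` polynomials in
the chart coordinates that do not vanish at `P`. The exponent is split as `k = m - n`. -/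
def HasOrder (P : Point f g) (φ : FunField f) (k : ℤ) : Prop :=
  ∃ (m n : ℕ) (p q : MvPolynomial (Fin 2) ℂ), k = (m : ℤ) - n ∧
    MvPolynomial.eval P.chartVal p ≠ 0 ∧ MvPolynomial.eval P.chartVal q ≠ 0 ∧
    φ * MvPolynomial.aeval P.chartFun q * P.unif ^ n =
      MvPolynomial.aeval P.chartFun p * P.unif ^ m

end Point

/-- The divisors of the nonzero rational functions on `y² = f(x)`. -/
def principal (f : ℂ[X]) (g : ℕ) : AddSubgroup (Point f g →₀ ℤ) where
  carrier := {D | ∃ φ : FunField f, IsUnit φ ∧ ∀ P : Point f g, P.HasOrder φ (D P)}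
  zero_mem' := ⟨1, isUnit_one, fun _ => ⟨0, 0, 1, 1, by simp, by simp, by simp, by simp⟩⟩
  add_mem' := by
    rintro D D' ⟨φ, hφ, h⟩ ⟨φ', hφ', h'⟩
    refine ⟨φ * φ', hφ.mul hφ', fun P => ?_⟩
    obtain ⟨m, n, p, q, hk, hp, hq, e⟩ := h P
    obtain ⟨m', n', p', q', hk', hp', hq', e'⟩ := h' P
    refine ⟨m + m', n + n', p * p', q * q', ?_, ?_, ?_, ?_⟩
    · rw [Finsupp.add_apply, hk, hk']; push_cast; ring
    · rw [map_mul]; exact mul_ne_zero hp hp'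
    · rw [map_mul]; exact mul_ne_zero hq hq'
    · rw [map_mul, map_mul, pow_add, pow_add]
      linear_combination (φ' * MvPolynomial.aeval P.chartFun q' * P.unif ^ n') * e +
        (MvPolynomial.aeval P.chartFun p * P.unif ^ m) * e'
  neg_mem' := by
    rintro D ⟨φ, hφ, h⟩
    obtain ⟨ψ, hψ⟩ := hφ.exists_right_inv
    refine ⟨ψ, IsUnit.of_mul_eq_one φ (by rw [mul_comm, hψ]), fun P => ?_⟩
    obtain ⟨m, n, p, q, hk, hp, hq, e⟩ := h P
    refine ⟨n, m, q, p, ?_, hq, hp, ?_⟩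
    · rw [Finsupp.neg_apply, hk]; ring
    · linear_combination (-ψ) * e + (MvPolynomial.aeval P.chartFun q * P.unif ^ n) * hψ

/-- The group of divisors of degree zero. -/
abbrev DivZero (f : ℂ[X]) (g : ℕ) : AddSubgroup (Point f g →₀ ℤ) :=
  (Finsupp.degree : (Point f g →₀ ℤ) →+ ℤ).ker

/-- The group of complex points of the Jacobian: divisors of degree zero up to linear
equivalence. -/
abbrev Jac (f : ℂ[X]) (g : ℕ) : Type :=
  DivZero f g ⧸ (principal f g).addSubgroupOf (DivZero f g)

/-- The class `[P - Q]` in the Jacobian. -/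
def diff {f : ℂ[X]} {g : ℕ} (P Q : Point f g) : Jac f g :=
  QuotientAddGroup.mk (s := (principal f g).addSubgroupOf (DivZero f g))
    ⟨Finsupp.single P 1 - Finsupp.single Q 1, by simp [AddMonoidHom.mem_ker]⟩

/-- A torsion packet: a maximal set of points whose pairwise differences have finite order in the
Jacobian. -/
def IsTorsionPacket {f : ℂ[X]} {g : ℕ} (T : Set (Point f g)) : Prop :=
  Maximal (fun S : Set (Point f g) => ∀ P ∈ S, ∀ Q ∈ S, IsOfFinAddOrder (diff P Q)) T

/-- The hyperelliptic torsion packet: the torsion packet that contains the ramification points of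
the hyperelliptic double cover. -/
def IsHyperellipticTorsionPacket {f : ℂ[X]} {g : ℕ} (T : Set (Point f g)) : Prop :=
  IsTorsionPacket T ∧ Point.ramification f g ⊆ T

/-- The torsion points of the elliptic curve `y² = f(x)`, `deg f ∈ {3, 4}`, with origin `O`.
The group law is the one for which `P ↦ [P - O]` is an isomorphism onto the Jacobian. -/
def torsionPoints {f : ℂ[X]} (O : Point f 1) : Set (Point f 1) :=
  {P | IsOfFinAddOrder (diff P O)}

/-- The common torsion `x`-coordinates `π₁(E₁,tors) ∩ π₂(E₂,tors)` of two elliptic curves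
`Eⱼ : y² = fⱼ(x)` with origins `Oⱼ`, where `πⱼ` is the `x`-coordinate. -/
def commonTorsion {f₁ f₂ : ℂ[X]} (O₁ : Point f₁ 1) (O₂ : Point f₂ 1) : Set (OnePoint ℂ) :=
  Point.xMap '' torsionPoints O₁ ∩ Point.xMap '' torsionPoints O₂

/-- The right-hand side of the genus two curve `C : y² = (x² - u)(x² - v)(x² - w)`. -/
def polyC (u v w : ℂ) : ℂ[X] := (X ^ 2 - C u) * (X ^ 2 - C v) * (X ^ 2 - C w)

/-- The right-hand side of the elliptic curve `E : y² = (x - u)(x - v)(x - w)`. -/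
def polyE (u v w : ℂ) : ℂ[X] := (X - C u) * (X - C v) * (X - C w)

/-- The right-hand side of the elliptic curve `E' : y² = x(x - u)(x - v)(x - w)`. -/
def polyE' (u v w : ℂ) : ℂ[X] := X * (X - C u) * (X - C v) * (X - C w)

theorem coeff_polyE (u v w : ℂ) : (polyE u v w).coeff (2 * 1 + 2) = 0 := by
  apply coeff_eq_zero_of_natDegree_lt
  have : (polyE u v w).natDegree ≤ 3 := by unfold polyE; compute_degree
  omega

theorem coeff_polyC (u v w : ℂ) : (polyC u v w).coeff (2 * 2 + 2) = 1 := by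
  unfold polyC; compute_degree!

theorem coeff_polyE' (u v w : ℂ) : (polyE' u v w).coeff (2 * 1 + 2) = 1 := by
  unfold polyE'; compute_degree!

/-- The quotient map `ψ : C → E`, `(x, y) ↦ (x², y)`, by the involution `(x, y) ↦ (-x, y)`. -/
def psi {u v w : ℂ} : Point (polyC u v w) 2 → Point (polyE u v w) 1
  | .affine a b h => .affine (a ^ 2) b (by simpa [polyC, polyE] using h)
  | .infty _ _ => .infty 0 (by rw [coeff_polyE]; norm_num)

/-- The quotient map `ψ' : C → E'`, `(x, y) ↦ (x², xy)`, by the involution `(x, y) ↦ (-x, -y)`.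
At infinity, `xy/(x²)² = y/x³`. -/
def psi' {u v w : ℂ} : Point (polyC u v w) 2 → Point (polyE' u v w) 1
  | .affine a b h => .affine (a ^ 2) (a * b) (by
      rw [mul_pow, h]; simp [polyC, polyE']; ring)
  | .infty b h => .infty b (by rw [h, coeff_polyC, coeff_polyE'])

/-- The natural map `ρ : C → E ×_{ℙ¹} E' → ℙ¹`, which is `(x, y) ↦ x²`. -/
def rho {u v w : ℂ} (P : Point (polyC u v w) 2) : OnePoint ℂ := (psi P).xMap

theorem rho_eq_xMap_psi' {u v w : ℂ} (P : Point (polyC u v w) 2) : rho P = (psi' P).xMap := by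
  cases P <;> simp only [rho, psi, psi', Point.xMap]

end DoubleCover

end

/-!
Work with divisors up to linear equivalence and torsion, so that torsion packets are the fibres of
`P ↦ [P]`. The fibres of the `x`-coordinate are linearly equivalent, so all ramification points of
a double cover of `ℙ¹` share one class, and a point `Q` of `E` has torsion `x`-coordinate exactly
when `[Q]` is that class, whichever ramification point is the origin.

Let `τ : (x, y) ↦ (-x, y)` and `τ' : (x, y) ↦ (-x, -y)`, the composite of `τ` with the
hyperelliptic involution. Norms of functions show that `ψ` and `ψ'` map principal divisors to
principal divisors. Conversely, pulling back along `ψ` and `ψ'`, the classes of `ψ P` and `ψ' P`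
determine those of `P + τ P` and `P + τ' P`, hence that of
`2 P = (P + τ P) + (P + τ' P) - (τ P + τ' P)`, as `τ P + τ' P` is a fibre of the `x`-coordinate.
So two points of `C` lie in one packet if and only if their images in `E` and in `E'` do, and the
hyperelliptic packet is the preimage of the common torsion.

For the cardinality, `#q⁻¹(A) = 2 #A - #(A ∩ branch points)` for a double cover `q`; this is applied
to `E → ℙ¹`, branched over `u, v, w, ∞`, and to `ψ`, branched over the two points above `0`.
-/

noncomputable section

namespace DoubleCover

open QuadraticAlgebra

theorem exists_isCoprime_mul_eq {R : Type*} [CommRing R] [IsDomain R] [IsPrincipalIdealRing R]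
    (a b : R) : ∃ d a' b' : R, d * a' = a ∧ d * b' = b ∧ IsCoprime a' b' := by
  classical
  let _ := IsBezout.toGCDDomain R
  obtain ⟨a', b', ha, hb, hunit⟩ := extract_gcd a b
  exact ⟨_, a', b', ha.symm, hb.symm, (gcd_isUnit_iff a' b').1 hunit⟩

section Polynomial

theorem aeval_inv_reflect_mul_pow {R K : Type*} [CommSemiring R] [Field K] [Algebra R K] {x : K}
    (hx : x ≠ 0) {p : R[X]} {N : ℕ} (hN : p.natDegree ≤ N) :
    aeval x⁻¹ (p.reflect N) * x ^ N = aeval x p := by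
  let _ : Invertible x := invertibleOfNonzero hx
  simpa only [aeval_def, invOf_eq_inv] using eval₂_reflect_mul_pow (algebraMap R K) x N p hN

theorem exists_comp_X_sq_eq {R : Type*} [CommRing R] [NoZeroDivisors R] (h2 : (2 : R) ≠ 0)
    {p : R[X]} (hp : p.comp (-X) = p) : ∃ q : R[X], q.comp (X ^ 2) = p := by
  refine ⟨p.contract 2, ?_⟩
  rw [← expand_eq_comp_X_pow]
  ext n
  rw [coeff_expand two_pos, coeff_contract two_ne_zero]
  split_ifs with hn
  · rw [Nat.div_mul_cancel hn]
  · have hodd : Odd n := Nat.not_even_iff_odd.1 fun h => hn h.two_dvd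
    have hneg : -p.coeff n = p.coeff n := by
      conv_rhs => rw [← hp, show (-X : R[X]) = C (-1) * X by simp, comp_C_mul_X_coeff,
        hodd.neg_one_pow, mul_neg_one]
    refine ((mul_eq_zero.1 ?_).resolve_left h2).symm
    linear_combination -hneg

theorem separable_comp_X_pow {K : Type*} [Field K] {p : K[X]} (hp : p.Separable)
    (h0 : p.coeff 0 ≠ 0) {n : ℕ} (hn : (n : K) ≠ 0) : (p.comp (X ^ n)).Separable := by
  have hn0 : n ≠ 0 := by rintro rfl; exact hn Nat.cast_zero
  have hX : IsCoprime (p.comp (X ^ n)) (X ^ (n - 1)) := by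
    refine ((irreducible_X.coprime_iff_not_dvd.2 ?_).pow_left).symm
    rwa [X_dvd_iff, coeff_zero_eq_eval_zero, eval_comp, eval_pow, eval_X, zero_pow hn0,
      ← coeff_zero_eq_eval_zero]
  have hcomp : IsCoprime (p.comp (X ^ n)) (p.derivative.comp (X ^ n)) :=
    IsCoprime.map hp (compRingHom (X ^ n))
  rw [separable_def, derivative_comp, derivative_X_pow, mul_assoc,
    isCoprime_mul_unit_left_right (isUnit_C.2 hn.isUnit)]
  exact hX.mul_right hcomp

end Polynomial

section RatFunc

variable {K : Type*} [Field K]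

theorem nonZeroDivisors_le_comap_aeval {r : K[X]} (hr : 0 < r.natDegree) :
    nonZeroDivisors K[X] ≤ (nonZeroDivisors K[X]).comap (aeval r : K[X] →ₐ[K] K[X]) := by
  refine nonZeroDivisors_le_comap_nonZeroDivisors_of_injective _
    ((injective_iff_map_eq_zero _).2 fun p hp => ?_)
  rcases comp_eq_zero_iff.1 hp with hp | ⟨-, hr'⟩
  · exact hp
  · rw [hr', natDegree_C] at hr
    exact absurd hr (lt_irrefl 0)

/-- The substitution `x ↦ r(x)` on `K(x)`, for a nonconstant polynomial `r`. -/
def ratFuncComp (r : K[X]) (hr : 0 < r.natDegree) : RatFunc K →ₐ[K] RatFunc K :=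
  RatFunc.mapAlgHom (aeval r) (nonZeroDivisors_le_comap_aeval hr)

theorem ratFuncComp_algebraMap (r : K[X]) (hr : 0 < r.natDegree) (p : K[X]) :
    ratFuncComp r hr (algebraMap K[X] (RatFunc K) p) = algebraMap K[X] (RatFunc K) (p.comp r) := by
  have h := RatFunc.map_apply_div (aeval r) (nonZeroDivisors_le_comap_aeval hr) p 1
  rwa [map_one, map_one, map_one, div_one, div_one] at h

theorem ratFuncComp_X (r : K[X]) (hr : 0 < r.natDegree) :
    ratFuncComp r hr RatFunc.X = algebraMap K[X] (RatFunc K) r := by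
  rw [← RatFunc.algebraMap_X, ratFuncComp_algebraMap, X_comp]

theorem natDegree_neg_X_pos : 0 < (-X : K[X]).natDegree := by simp

theorem natDegree_X_sq_pos : 0 < (X ^ 2 : K[X]).natDegree := by simp

theorem ratFuncComp_neg_X_ratFuncComp_neg_X (α : RatFunc K) :
    ratFuncComp (-X) natDegree_neg_X_pos (ratFuncComp (-X) natDegree_neg_X_pos α) = α := by
  rw [← RatFunc.num_div_denom α]
  simp only [map_div₀, ratFuncComp_algebraMap, comp_neg_X_comp_neg_X]

theorem exists_ratFuncComp_X_sq_eq (h2 : (2 : K) ≠ 0) {α : RatFunc K}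
    (hα : ratFuncComp (-X) natDegree_neg_X_pos α = α) :
    ∃ β, ratFuncComp (X ^ 2) natDegree_X_sq_pos β = α := by
  have hD : α.denom.comp (-X) ≠ 0 := comp_neg_X_eq_zero_iff.not.2 α.denom_ne_zero
  obtain ⟨E, hE⟩ := exists_comp_X_sq_eq h2 (p := α.denom * α.denom.comp (-X)) (by
    rw [mul_comp, comp_neg_X_comp_neg_X, mul_comm])
  have hE0 : algebraMap K[X] (RatFunc K) (E.comp (X ^ 2)) ≠ 0 :=
    RatFunc.algebraMap_ne_zero (hE ▸ mul_ne_zero α.denom_ne_zero hD)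
  have hnum : α * algebraMap K[X] (RatFunc K) (E.comp (X ^ 2)) =
      algebraMap K[X] (RatFunc K) (α.num * α.denom.comp (-X)) := by
    nth_rewrite 1 [← α.num_div_denom]
    rw [hE, map_mul, map_mul, ← mul_assoc,
      div_mul_cancel₀ _ (RatFunc.algebraMap_ne_zero α.denom_ne_zero)]
  obtain ⟨M, hM⟩ := exists_comp_X_sq_eq h2 (p := α.num * α.denom.comp (-X)) (by
    apply RatFunc.algebraMap_injective K
    rw [← ratFuncComp_algebraMap _ natDegree_neg_X_pos, ← hnum, map_mul, hα,
      ratFuncComp_algebraMap, comp_assoc, X_pow_comp, neg_sq])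
  refine ⟨algebraMap K[X] (RatFunc K) M / algebraMap K[X] (RatFunc K) E, ?_⟩
  rw [map_div₀, ratFuncComp_algebraMap, ratFuncComp_algebraMap, hM, ← hnum,
    mul_div_cancel_right₀ _ hE0]

end RatFunc

section QuadraticMap

variable {k K L : Type*} [CommRing k] [CommRing K] [Algebra k K]

section CommRing

variable [CommRing L] [Algebra k L] (σ : K →ₐ[k] L) {a : K} {b c : L} (h : c ^ 2 * b = σ a)

/-- The homomorphism `K[√a] → L[√b]` extending `σ : K → L` by `√a ↦ c √b`. -/
def quadraticMap : QuadraticAlgebra K a 0 →ₐ[k] QuadraticAlgebra L b 0 where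
  toFun z := ⟨σ z.re, c * σ z.im⟩
  map_one' := by ext <;> simp
  map_zero' := by ext <;> simp
  map_add' z w := by ext <;> simp [mul_add]
  map_mul' z w := by
    ext
    · simp only [re_mul, map_add, map_mul]
      linear_combination (-(σ z.im * σ w.im)) * h
    · simp only [im_mul, map_add, map_mul, map_zero]
      ring
  commutes' r := by
    ext
    · exact σ.commutes r
    · exact (congrArg (c * ·) (map_zero σ)).trans (mul_zero c)

theorem quadraticMap_algebraMap (α : K) :
    quadraticMap σ h (algebraMap K (QuadraticAlgebra K a 0) α) =
      algebraMap L (QuadraticAlgebra L b 0) (σ α) := by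
  ext <;> simp [quadraticMap]

theorem quadraticMap_omega :
    quadraticMap σ h omega = algebraMap L (QuadraticAlgebra L b 0) c * omega := by
  ext <;> simp [quadraticMap]

theorem norm_quadraticMap (z : QuadraticAlgebra K a 0) :
    (quadraticMap σ h z).norm = σ z.norm := by
  simp only [norm_def, quadraticMap, AlgHom.coe_mk, RingHom.coe_mk, MonoidHom.coe_mk,
    OneHom.coe_mk, map_sub, map_add, map_mul, map_zero]
  linear_combination (-σ z.im ^ 2) * h

theorem isLocalHom_quadraticMap [IsLocalHom σ] : IsLocalHom (quadraticMap σ h) where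
  map_nonunit z hz := by
    rw [isUnit_iff_norm_isUnit, norm_quadraticMap] at hz
    exact isUnit_iff_norm_isUnit.2 (isUnit_of_map_unit σ _ hz)

end CommRing

theorem quadraticMap_quadraticMap_self {σ : K →ₐ[k] K} (hσ : ∀ α, σ (σ α) = α) {a c : K}
    (h : c ^ 2 * a = σ a) (hc : c * σ c = 1) (z : QuadraticAlgebra K a 0) :
    quadraticMap σ h (quadraticMap σ h z) = z := by
  ext
  · exact hσ z.re
  · change c * σ (c * σ z.im) = z.im
    rw [map_mul, hσ, ← mul_assoc, hc, one_mul]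

theorem exists_quadraticMap_eq [Field L] [Algebra k L] {σ : K →ₐ[k] L} {s : L →ₐ[k] L} {a : K}
    {b c ε : L} (h : c ^ 2 * b = σ a) (hs : ε ^ 2 * b = s b)
    (hfix : ∀ α, s α = α → ∃ β, σ β = α) (hc : ε * s c = c) (hc0 : c ≠ 0)
    {z : QuadraticAlgebra L b 0} (hz : quadraticMap s hs z = z) :
    ∃ w, quadraticMap σ h w = z := by
  have hre : s z.re = z.re := congrArg QuadraticAlgebra.re hz
  have him : ε * s z.im = z.im := congrArg QuadraticAlgebra.im hz
  obtain ⟨x, hx⟩ := hfix _ hre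
  obtain ⟨y, hy⟩ := hfix (z.im / c) (by
    have hε : ε ≠ 0 := by rintro rfl; exact hc0 (by rw [← hc, zero_mul])
    rw [map_div₀, ← mul_div_mul_left _ _ hε, him, hc])
  refine ⟨⟨x, y⟩, ?_⟩
  ext
  · exact hx
  · change c * σ y = z.im
    rw [hy, mul_div_cancel₀ _ hc0]

end QuadraticMap

section OrbitMap

variable {α β : Type*}

/-- The map `q` is the quotient of `α` by the involution `τ`: it is surjective with fibres
`{a, τ a}`. That `τ` is an involution follows, see `IsOrbitMap.involutive`. -/
structure IsOrbitMap (q : α → β) (τ : α → α) : Prop where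
  surjective : Function.Surjective q
  apply_eq_apply_iff (a b : α) : q a = q b ↔ b = a ∨ b = τ a

/-- The ramification index at `a` of the quotient by the involution `τ`. -/
def ramificationIndex (τ : α → α) (a : α) : ℤ :=
  open Classical in if τ a = a then 2 else 1

/-- The divisor `a + τ a`. -/
def orbitDivisor (τ : α → α) (a : α) : α →₀ ℤ :=
  Finsupp.single a 1 + Finsupp.single (τ a) 1

theorem ramificationIndex_ne_zero (τ : α → α) (a : α) : ramificationIndex τ a ≠ 0 := by
  unfold ramificationIndex
  split_ifs <;> norm_num

namespace IsOrbitMap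

variable {q : α → β} {τ : α → α}

theorem apply_apply (h : IsOrbitMap q τ) (a : α) : q (τ a) = q a :=
  ((h.apply_eq_apply_iff a (τ a)).2 (.inr rfl)).symm

theorem involutive (h : IsOrbitMap q τ) : Function.Involutive τ := fun a => by
  rcases (h.apply_eq_apply_iff _ _).1 (h.apply_apply a) with ha | ha
  · rw [← ha, ← ha]
  · exact ha.symm

open Classical in
theorem orbitDivisor_apply (h : IsOrbitMap q τ) (a b : α) :
    orbitDivisor τ a b = if q a = q b then ramificationIndex τ b else 0 := by
  rw [orbitDivisor, Finsupp.add_apply, Finsupp.single_apply, Finsupp.single_apply]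
  by_cases hq : q a = q b
  · rw [if_pos hq, ramificationIndex]
    rcases (h.apply_eq_apply_iff a b).1 hq with rfl | rfl
    · by_cases hb : τ b = b <;> simp [hb]
    · rw [h.involutive a]
      by_cases ha : τ a = a
      · simp [ha]
      · simp [Ne.symm ha]
  · have hba : b ≠ a ∧ b ≠ τ a := not_or.1 (mt (h.apply_eq_apply_iff a b).2 hq)
    rw [if_neg hq, if_neg hba.1.symm, if_neg hba.2.symm, add_zero]

theorem ramificationIndex_mul_mapDomain (h : IsOrbitMap q τ) (D : α →₀ ℤ) (b : α) :
    ramificationIndex τ b * D.mapDomain q (q b) = (D + D.mapDomain τ) b := by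
  classical
  induction D using Finsupp.induction_linear with
  | zero => simp
  | add D D' hD hD' =>
    rw [Finsupp.mapDomain_add, Finsupp.mapDomain_add, Finsupp.add_apply, mul_add, hD, hD',
      add_add_add_comm, ← Finsupp.add_apply]
  | single a n =>
    have := congrArg (n * ·) (h.orbitDivisor_apply a b)
    simp only [orbitDivisor, Finsupp.add_apply, Finsupp.single_apply, Finsupp.mapDomain_single,
      mul_ite, mul_add, mul_one, mul_zero] at this ⊢
    rw [this, mul_comm]

theorem preimage_eq_image_union_image (h : IsOrbitMap q τ) {s : β → α}
    (hs : Function.RightInverse s q) (A : Set β) : q ⁻¹' A = s '' A ∪ (τ ∘ s) '' A := by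
  ext a
  constructor
  · intro ha
    exact ((h.apply_eq_apply_iff (s (q a)) a).1 (hs _)).imp
      (fun h => ⟨q a, ha, h.symm⟩) (fun h => ⟨q a, ha, h.symm⟩)
  · rintro (⟨b, hb, rfl⟩ | ⟨b, hb, rfl⟩)
    · rwa [Set.mem_preimage, hs]
    · rwa [Set.mem_preimage, Function.comp_apply, h.apply_apply, hs]

theorem image_inter_image_eq (h : IsOrbitMap q τ) {s : β → α}
    (hs : Function.RightInverse s q) (A : Set β) :
    s '' A ∩ (τ ∘ s) '' A = s '' (A ∩ q '' Function.fixedPoints τ) := by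
  ext a
  constructor
  · rintro ⟨⟨b, hb, rfl⟩, b', -, hb'⟩
    have hbb' : b' = b := by rw [← hs b, ← hb', Function.comp_apply, h.apply_apply, hs]
    exact ⟨b, ⟨hb, s b, hbb' ▸ hb', hs b⟩, rfl⟩
  · rintro ⟨b, ⟨hb, c, hc, rfl⟩, rfl⟩
    have hsc : s (q c) = c := by
      rcases (h.apply_eq_apply_iff c (s (q c))).1 (hs _).symm with h' | h'
      · exact h'
      · rw [h', hc]
    exact ⟨⟨q c, hb, rfl⟩, q c, hb, by rw [Function.comp_apply, hsc, hc]⟩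

theorem encard_preimage_add (h : IsOrbitMap q τ) (A : Set β) :
    (q ⁻¹' A).encard + (A ∩ q '' Function.fixedPoints τ).encard = 2 * A.encard := by
  obtain ⟨s, hs⟩ := h.surjective.hasRightInverse
  rw [h.preimage_eq_image_union_image hs, ← hs.injective.encard_image (A ∩ _),
    ← h.image_inter_image_eq hs, Set.encard_union_add_encard_inter, hs.injective.encard_image,
    (h.involutive.injective.comp hs.injective).encard_image, two_mul]

end IsOrbitMap

end OrbitMap

/-- The conditions on `f` under which `Point f g` is the smooth projective model of `y² = f(x)`. -/
structure IsSmoothModel (f : ℂ[X]) (g : ℕ) : Prop where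
  separable : f.Separable
  natDegree_eq : f.natDegree = 2 * g + 1 ∨ f.natDegree = 2 * g + 2

theorem IsSmoothModel.natDegree_le {f : ℂ[X]} {g : ℕ} (hf : IsSmoothModel f g) :
    f.natDegree ≤ 2 * g + 2 := by
  rcases hf.natDegree_eq with h | h <;> omega

namespace Point

variable {f : ℂ[X]} {g : ℕ}

/-- The first chart coordinate at `P`, as an element of `ℂ(x)`. -/
def base : Point f g → RatFunc ℂ
  | affine _ _ _ => RatFunc.X
  | infty _ _ => RatFunc.X⁻¹

/-- The factor in `ℂ(x)` by which the second chart coordinate at `P` differs from `y`. -/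
def scale : Point f g → RatFunc ℂ
  | affine _ _ _ => 1
  | infty _ _ => RatFunc.X⁻¹ ^ (g + 1)

/-- The polynomial `h` such that `t² = h(s)` for the chart coordinates `(s, t)` used at `P`. -/
def chartPoly : Point f g → ℂ[X]
  | affine _ _ _ => f
  | infty _ _ => f.reflect (2 * g + 2)

theorem chartFun_zero (P : Point f g) :
    P.chartFun 0 = algebraMap (RatFunc ℂ) (FunField f) P.base := by
  cases P <;> rfl

theorem chartFun_one (P : Point f g) :
    P.chartFun 1 = algebraMap (RatFunc ℂ) (FunField f) P.scale * omega := by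
  cases P <;> simp [chartFun, scale]

theorem scale_ne_zero (P : Point f g) : P.scale ≠ 0 := by
  cases P
  · exact one_ne_zero
  · exact pow_ne_zero _ (inv_ne_zero RatFunc.X_ne_zero)

theorem transcendental_base (P : Point f g) : Transcendental ℂ P.base := by
  cases P
  · exact RatFunc.transcendental_X
  · exact fun h => RatFunc.transcendental_X (IsAlgebraic.inv_iff.1 h)

theorem aeval_base_eq_zero_iff (P : Point f g) {A : ℂ[X]} : aeval P.base A = 0 ↔ A = 0 :=
  ⟨transcendental_iff.1 P.transcendental_base A, fun h => by rw [h, map_zero]⟩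

theorem aeval_chartFun_zero (P : Point f g) (A : ℂ[X]) :
    aeval (P.chartFun 0) A = algebraMap (RatFunc ℂ) (FunField f) (aeval P.base A) := by
  rw [chartFun_zero, aeval_algebraMap_apply]

theorem exists_mul_aeval_base_eq (P : Point f g) (α : RatFunc ℂ) :
    ∃ A D : ℂ[X], D ≠ 0 ∧ α * aeval P.base D = aeval P.base A := by
  have hα : α * aeval RatFunc.X α.denom = aeval RatFunc.X α.num := by
    simp only [RatFunc.aeval_X_left_eq_algebraMap]
    exact ((div_eq_iff (RatFunc.algebraMap_ne_zero α.denom_ne_zero)).1 α.num_div_denom).symm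
  cases P with
  | affine a b h => exact ⟨α.num, α.denom, α.denom_ne_zero, hα⟩
  | infty b h =>
    set N := max α.num.natDegree α.denom.natDegree
    refine ⟨α.num.reflect N, α.denom.reflect N, reflect_eq_zero_iff.not.2 α.denom_ne_zero, ?_⟩
    refine mul_right_cancel₀ (pow_ne_zero N RatFunc.X_ne_zero) ?_
    rw [mul_assoc, base, aeval_inv_reflect_mul_pow RatFunc.X_ne_zero (le_max_right _ _),
      aeval_inv_reflect_mul_pow RatFunc.X_ne_zero (le_max_left _ _), hα]

theorem omega_sq : (omega : FunField f) ^ 2 =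
    algebraMap (RatFunc ℂ) (FunField f) (algebraMap ℂ[X] (RatFunc ℂ) f) := by
  rw [sq, omega_mul_omega_eq_mk]; rfl

theorem chartFun_one_sq (hf : f.natDegree ≤ 2 * g + 2) (P : Point f g) :
    P.chartFun 1 ^ 2 = aeval (P.chartFun 0) P.chartPoly := by
  rw [aeval_chartFun_zero, chartFun_one, mul_pow, omega_sq, ← map_pow, ← map_mul]
  congr 1
  rw [← RatFunc.aeval_X_left_eq_algebraMap]
  cases P with
  | affine a b h => rw [scale, base, chartPoly, one_pow, one_mul]
  | infty b h =>
    rw [scale, base, chartPoly, ← aeval_inv_reflect_mul_pow RatFunc.X_ne_zero hf, ← pow_mul,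
      show (g + 1) * 2 = 2 * g + 2 by ring, mul_left_comm, ← mul_pow,
      inv_mul_cancel₀ RatFunc.X_ne_zero, one_pow, mul_one]

theorem chartVal_one_sq (P : Point f g) :
    P.chartVal 1 ^ 2 = P.chartPoly.eval (P.chartVal 0) := by
  cases P with
  | affine a b h => exact h
  | infty b h =>
    simp only [chartVal, chartPoly, Matrix.cons_val_zero, Matrix.cons_val_one]
    rw [h, ← coeff_zero_eq_eval_zero, coeff_reflect, revAt_le (Nat.zero_le _), Nat.sub_zero]

theorem eval_derivative_chartPoly_ne_zero (hf : IsSmoothModel f g) {P : Point f g}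
    (hP : P.chartVal 1 = 0) : P.chartPoly.derivative.eval (P.chartVal 0) ≠ 0 := by
  have hroot := P.chartVal_one_sq
  rw [hP, zero_pow two_ne_zero] at hroot
  cases P with
  | affine a b e => exact hf.separable.eval₂_derivative_ne_zero (RingHom.id ℂ) hroot.symm
  | infty b e =>
    obtain rfl : b = 0 := hP
    have hlead : f.coeff (2 * g + 2) = 0 := by rw [← e, zero_pow two_ne_zero]
    have hdeg : f.natDegree = 2 * g + 1 := hf.natDegree_eq.resolve_right fun h => by
      rw [← h, coeff_natDegree, leadingCoeff_eq_zero] at hlead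
      exact hf.separable.ne_zero hlead
    change (f.reflect (2 * g + 2)).derivative.eval 0 ≠ 0
    rw [← coeff_zero_eq_eval_zero, coeff_derivative, coeff_reflect, revAt_le (by omega)]
    simpa [← hdeg] using hf.separable.ne_zero

theorem exists_chartPoly_eq (hf : IsSmoothModel f g) {P : Point f g} (hP : P.chartVal 1 = 0) :
    ∃ h : ℂ[X], P.chartPoly = (X - C (P.chartVal 0)) * h ∧ h.eval (P.chartVal 0) ≠ 0 := by
  have hroot : P.chartPoly.IsRoot (P.chartVal 0) := by
    rw [IsRoot, ← chartVal_one_sq, hP, zero_pow two_ne_zero]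
  obtain ⟨h, hh⟩ := dvd_iff_isRoot.2 hroot
  refine ⟨h, hh, fun h0 => eval_derivative_chartPoly_ne_zero hf hP ?_⟩
  simp [hh, h0]

/-- The function `A(s) + B(s) t`, where `(s, t)` are the chart coordinates used at `P`. -/
def chartSum (P : Point f g) (A B : ℂ[X]) : FunField f :=
  aeval (P.chartFun 0) A + aeval (P.chartFun 0) B * P.chartFun 1

theorem chartSum_eq_zero_iff (P : Point f g) {A B : ℂ[X]} :
    P.chartSum A B = 0 ↔ A = 0 ∧ B = 0 := by
  refine ⟨fun h => ?_, fun h => by simp [chartSum, h]⟩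
  rw [chartSum, aeval_chartFun_zero, aeval_chartFun_zero, chartFun_one] at h
  have hre := congrArg QuadraticAlgebra.re h
  have him := congrArg QuadraticAlgebra.im h
  simp only [re_add, im_add, re_mul, im_mul, algebraMap_re, algebraMap_im, omega_re, omega_im,
    re_zero, im_zero, mul_zero, zero_mul, add_zero, zero_add, mul_one] at hre him
  exact ⟨P.aeval_base_eq_zero_iff.1 hre,
    P.aeval_base_eq_zero_iff.1 ((mul_eq_zero.1 him).resolve_right P.scale_ne_zero)⟩

theorem aeval_mul_chartSum (P : Point f g) (D A B : ℂ[X]) :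
    aeval (P.chartFun 0) D * P.chartSum A B = P.chartSum (D * A) (D * B) := by
  simp only [chartSum, map_mul]
  ring

theorem chartSum_mul_chartSum_neg (hf : f.natDegree ≤ 2 * g + 2) (P : Point f g) (A B : ℂ[X]) :
    P.chartSum A B * P.chartSum A (-B) =
      aeval (P.chartFun 0) (A ^ 2 - B ^ 2 * P.chartPoly) := by
  simp only [chartSum, map_sub, map_mul, map_pow, map_neg, ← P.chartFun_one_sq hf]
  ring

theorem exists_mul_aeval_eq_chartSum (P : Point f g) (φ : FunField f) :
    ∃ A B D : ℂ[X], D ≠ 0 ∧ φ * aeval (P.chartFun 0) D = P.chartSum A B := by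
  obtain ⟨A, D, hD, hA⟩ := P.exists_mul_aeval_base_eq φ.re
  obtain ⟨B, D', hD', hB⟩ := P.exists_mul_aeval_base_eq (φ.im / P.scale)
  rw [div_mul_eq_mul_div, div_eq_iff P.scale_ne_zero] at hB
  refine ⟨A * D', B * D, D * D', mul_ne_zero hD hD', ?_⟩
  simp only [chartSum, aeval_chartFun_zero, chartFun_one]
  ext
  · simp only [re_add, re_mul, im_mul, algebraMap_re, algebraMap_im, omega_re, omega_im, map_mul]
    linear_combination aeval P.base D' * hA
  · simp only [im_add, re_mul, im_mul, algebraMap_re, algebraMap_im, omega_re, omega_im, map_mul]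
    linear_combination aeval P.base D * hB

theorem exists_aeval_eq_chartSum (hf : f.natDegree ≤ 2 * g + 2) (P : Point f g)
    (p : MvPolynomial (Fin 2) ℂ) : ∃ A B : ℂ[X],
      MvPolynomial.aeval P.chartFun p = P.chartSum A B ∧
      MvPolynomial.eval P.chartVal p =
        A.eval (P.chartVal 0) + B.eval (P.chartVal 0) * P.chartVal 1 := by
  induction p using MvPolynomial.induction_on with
  | C a => exact ⟨C a, 0, by simp [chartSum]⟩
  | add p q hp hq =>
    obtain ⟨A, B, h, hv⟩ := hp
    obtain ⟨A', B', h', hv'⟩ := hq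
    refine ⟨A + A', B + B', ?_, ?_⟩
    · simp only [chartSum, map_add, h, h']; ring
    · simp only [map_add, eval_add, hv, hv']; ring
  | mul_X p i hp =>
    obtain ⟨A, B, h, hv⟩ := hp
    fin_cases i
    · refine ⟨X * A, X * B, ?_, ?_⟩
      · simp only [chartSum, map_mul, h, aeval_X, MvPolynomial.aeval_X, Fin.zero_eta]; ring
      · simp only [map_mul, hv, eval_mul, eval_X, MvPolynomial.eval_X, Fin.zero_eta]; ring
    · refine ⟨B * P.chartPoly, A, ?_, ?_⟩
      · simp only [chartSum, map_mul, h, ← P.chartFun_one_sq hf, MvPolynomial.aeval_X,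
          Fin.mk_one]; ring
      · simp only [map_mul, hv, eval_mul, ← P.chartVal_one_sq, MvPolynomial.eval_X,
          Fin.mk_one]; ring

theorem eval_chartVal_eq_zero (hf : f.natDegree ≤ 2 * g + 2) (P : Point f g)
    {p : MvPolynomial (Fin 2) ℂ} (h : MvPolynomial.aeval P.chartFun p = 0) :
    MvPolynomial.eval P.chartVal p = 0 := by
  obtain ⟨A, B, hfun, hval⟩ := P.exists_aeval_eq_chartSum hf p
  obtain ⟨rfl, rfl⟩ := P.chartSum_eq_zero_iff.1 (hfun.symm.trans h)
  simpa using hval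

theorem invol_eq_self_iff {P : Point f g} : P.invol = P ↔ P.chartVal 1 = 0 := by
  cases P <;> simp [invol, chartVal, neg_eq_self]

theorem unif_of_eq_zero {P : Point f g} (h : P.chartVal 1 = 0) : P.unif = P.chartFun 1 := by
  rw [unif, if_pos h]

theorem unif_of_ne_zero {P : Point f g} (h : P.chartVal 1 ≠ 0) :
    P.unif = P.chartFun 0 - algebraMap ℂ (FunField f) (P.chartVal 0) := by
  rw [unif, if_neg h]

theorem isUnit_aeval_chartFun_zero (P : Point f g) {A : ℂ[X]} (hA : A ≠ 0) :
    IsUnit (aeval (P.chartFun 0) A) := by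
  rw [aeval_chartFun_zero]
  exact (isUnit_iff_ne_zero.2 (P.aeval_base_eq_zero_iff.not.2 hA)).map _

theorem isUnit_chartFun_one (hf : f ≠ 0) (P : Point f g) : IsUnit (P.chartFun 1) := by
  rw [← isUnit_pow_iff two_ne_zero, chartFun_one, mul_pow, omega_sq, ← map_pow, ← map_mul]
  exact (isUnit_iff_ne_zero.2 (mul_ne_zero (pow_ne_zero 2 P.scale_ne_zero)
    (RatFunc.algebraMap_ne_zero hf))).map _

theorem isUnit_unif (hf : f ≠ 0) (P : Point f g) : IsUnit P.unif := by
  by_cases h : P.chartVal 1 = 0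
  · rw [unif_of_eq_zero h]
    exact P.isUnit_chartFun_one hf
  · rw [unif_of_ne_zero h]
    simpa using P.isUnit_aeval_chartFun_zero (X_sub_C_ne_zero (P.chartVal 0))

theorem exists_aeval_eq_unif (P : Point f g) : ∃ r : MvPolynomial (Fin 2) ℂ,
    MvPolynomial.aeval P.chartFun r = P.unif ∧ MvPolynomial.eval P.chartVal r = 0 := by
  by_cases h : P.chartVal 1 = 0
  · exact ⟨MvPolynomial.X 1, by rw [MvPolynomial.aeval_X, unif_of_eq_zero h],
      by rwa [MvPolynomial.eval_X]⟩
  · exact ⟨MvPolynomial.X 0 - MvPolynomial.C (P.chartVal 0), by simp [unif_of_ne_zero h], by simp⟩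

namespace HasOrder

variable {P : Point f g} {φ ψ : FunField f} {k l : ℤ}

theorem mul (h : P.HasOrder φ k) (h' : P.HasOrder ψ l) : P.HasOrder (φ * ψ) (k + l) := by
  obtain ⟨m, n, p, q, rfl, hp, hq, e⟩ := h
  obtain ⟨m', n', p', q', rfl, hp', hq', e'⟩ := h'
  refine ⟨m + m', n + n', p * p', q * q', ?_, ?_, ?_, ?_⟩
  · push_cast; ring
  · rw [map_mul]; exact mul_ne_zero hp hp'
  · rw [map_mul]; exact mul_ne_zero hq hq'
  · rw [map_mul, map_mul, pow_add, pow_add]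
    linear_combination (ψ * MvPolynomial.aeval P.chartFun q' * P.unif ^ n') * e +
      (MvPolynomial.aeval P.chartFun p * P.unif ^ m) * e'

theorem of_mul (h : P.HasOrder ψ l) (h' : P.HasOrder (φ * ψ) k) : P.HasOrder φ (k - l) := by
  obtain ⟨m, n, p, q, rfl, hp, hq, e⟩ := h
  obtain ⟨m', n', p', q', rfl, hp', hq', e'⟩ := h'
  refine ⟨m' + n, n' + m, p' * q, q' * p, ?_, ?_, ?_, ?_⟩
  · push_cast; ring
  · rw [map_mul]; exact mul_ne_zero hp' hq
  · rw [map_mul]; exact mul_ne_zero hq' hp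
  · rw [map_mul, map_mul, pow_add, pow_add]
    linear_combination (MvPolynomial.aeval P.chartFun q * P.unif ^ n) * e' -
      (φ * MvPolynomial.aeval P.chartFun q' * P.unif ^ n') * e

theorem aeval {p : MvPolynomial (Fin 2) ℂ} (hp : MvPolynomial.eval P.chartVal p ≠ 0) :
    P.HasOrder (MvPolynomial.aeval P.chartFun p) 0 :=
  ⟨0, 0, p, 1, by simp, hp, by simp, by simp⟩

theorem unif : P.HasOrder P.unif 1 :=
  ⟨1, 0, 1, 1, by simp, by simp, by simp, by simp⟩

theorem pow (h : P.HasOrder φ k) (n : ℕ) : P.HasOrder (φ ^ n) (n * k) := by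
  induction n with
  | zero => simpa using aeval (P := P) (p := 1) (by simp)
  | succ n ih => rw [pow_succ]; convert ih.mul h using 1; push_cast; ring

theorem nonpos_of_one (hf : IsSmoothModel f g) (h : P.HasOrder 1 k) : k ≤ 0 := by
  obtain ⟨m, n, p, q, rfl, -, hq, e⟩ := h
  obtain ⟨r, hr, hr0⟩ := P.exists_aeval_eq_unif
  by_contra hlt
  obtain ⟨j, rfl⟩ : ∃ j, m = j + 1 + n := ⟨m - n - 1, by omega⟩
  have hq_eq : MvPolynomial.aeval P.chartFun (q - p * r ^ (j + 1)) = 0 := by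
    refine ((P.isUnit_unif hf.separable.ne_zero).pow n).mul_left_eq_zero.1 ?_
    rw [map_sub, map_mul, map_pow, hr]
    linear_combination e
  refine hq ?_
  simpa [hr0] using P.eval_chartVal_eq_zero hf.natDegree_le hq_eq

theorem unique (hf : IsSmoothModel f g) (h : P.HasOrder φ k) (h' : P.HasOrder φ l) : k = l :=
  le_antisymm (sub_nonpos.1 (nonpos_of_one hf (h'.of_mul ((one_mul φ).symm ▸ h))))
    (sub_nonpos.1 (nonpos_of_one hf (h.of_mul ((one_mul φ).symm ▸ h'))))

theorem chartSum {A B : ℂ[X]}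
    (h : A.eval (P.chartVal 0) + B.eval (P.chartVal 0) * P.chartVal 1 ≠ 0) :
    P.HasOrder (P.chartSum A B) 0 := by
  have hev (D : ℂ[X]) : MvPolynomial.eval P.chartVal (Polynomial.aeval (MvPolynomial.X 0) D) =
      D.eval (P.chartVal 0) := by
    have := Polynomial.aeval_algHom_apply (MvPolynomial.aeval P.chartVal) (MvPolynomial.X 0) D
    rw [MvPolynomial.aeval_X, Polynomial.coe_aeval_eq_eval] at this
    exact this.symm
  have := aeval (P := P) (p := Polynomial.aeval (MvPolynomial.X 0) A +
    Polynomial.aeval (MvPolynomial.X 0) B * MvPolynomial.X 1) (by simpa [hev] using h)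
  simpa [Point.chartSum, ← Polynomial.aeval_algHom_apply] using this

theorem aeval_chartFun_zero {A : ℂ[X]} (h : A.eval (P.chartVal 0) ≠ 0) :
    P.HasOrder (Polynomial.aeval (P.chartFun 0) A) 0 := by
  simpa [Point.chartSum] using chartSum (P := P) (A := A) (B := 0) (by simpa using h)

end HasOrder

theorem hasOrder_chartFun_zero_sub (hf : IsSmoothModel f g) (P : Point f g) :
    P.HasOrder (P.chartFun 0 - algebraMap ℂ (FunField f) (P.chartVal 0))
      (ramificationIndex invol P) := by
  rw [ramificationIndex]
  split_ifs with hP <;> rw [invol_eq_self_iff] at hP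
  · obtain ⟨h, hh, h0⟩ := exists_chartPoly_eq hf hP
    have hsq : P.HasOrder (P.chartFun 1 ^ 2) 2 := by
      simpa [unif_of_eq_zero hP] using (HasOrder.unif (P := P)).pow 2
    rw [P.chartFun_one_sq hf.natDegree_le, hh, map_mul] at hsq
    simpa using (HasOrder.aeval_chartFun_zero h0).of_mul hsq
  · rw [← unif_of_ne_zero hP]
    exact HasOrder.unif

theorem exists_hasOrder_aeval (hf : IsSmoothModel f g) (P : Point f g) {A : ℂ[X]} (hA : A ≠ 0) :
    ∃ k, P.HasOrder (aeval (P.chartFun 0) A) k := by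
  obtain ⟨B, hB, hdvd⟩ := A.exists_eq_pow_rootMultiplicity_mul_and_not_dvd hA (P.chartVal 0)
  rw [dvd_iff_isRoot] at hdvd
  have h := ((P.hasOrder_chartFun_zero_sub hf).pow (A.rootMultiplicity (P.chartVal 0))).mul
    (HasOrder.aeval_chartFun_zero hdvd)
  have e := congrArg (aeval (P.chartFun 0)) hB
  rw [map_mul, map_pow, map_sub, aeval_X, aeval_C] at e
  exact ⟨_, e ▸ h⟩

theorem hasOrder_chartSum_of_eq_zero (hf : IsSmoothModel f g) {P : Point f g}
    (hP : P.chartVal 1 = 0) {A B : ℂ[X]} (hA : A.eval (P.chartVal 0) = 0)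
    (hB : B.eval (P.chartVal 0) ≠ 0) : P.HasOrder (P.chartSum A B) 1 := by
  obtain ⟨h, hh, h0⟩ := exists_chartPoly_eq hf hP
  obtain ⟨A₁, rfl⟩ := dvd_iff_isRoot.2 hA
  have hfactor : P.chartSum ((X - C (P.chartVal 0)) * A₁) B * aeval (P.chartFun 0) h =
      P.unif * P.chartSum (B * h) A₁ := by
    have hsq := P.chartFun_one_sq hf.natDegree_le
    rw [hh, map_mul] at hsq
    simp only [chartSum, map_mul, unif_of_eq_zero hP]
    linear_combination (-aeval (P.chartFun 0) A₁) * hsq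
  have hcofactor : P.HasOrder (P.chartSum (B * h) A₁) 0 := by
    refine HasOrder.chartSum ?_
    rw [hP, mul_zero, add_zero, eval_mul]
    exact mul_ne_zero hB h0
  simpa using (HasOrder.aeval_chartFun_zero h0).of_mul (hfactor ▸ HasOrder.unif.mul hcofactor)

theorem exists_hasOrder_chartSum (hf : IsSmoothModel f g) (P : Point f g) {A B : ℂ[X]}
    (hAB : IsCoprime A B) (hunit : IsUnit (P.chartSum A B)) :
    ∃ k, P.HasOrder (P.chartSum A B) k := by
  have hne : A.eval (P.chartVal 0) = 0 → B.eval (P.chartVal 0) ≠ 0 := fun hA hB => by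
    obtain ⟨r, s, hrs⟩ := hAB
    simpa [hA, hB] using congrArg (eval (P.chartVal 0)) hrs
  by_cases h0 : A.eval (P.chartVal 0) + B.eval (P.chartVal 0) * P.chartVal 1 = 0
  swap
  · exact ⟨0, HasOrder.chartSum h0⟩
  by_cases hP : P.chartVal 1 = 0
  · have hA : A.eval (P.chartVal 0) = 0 := by simpa [hP] using h0
    exact ⟨1, hasOrder_chartSum_of_eq_zero hf hP hA (hne hA)⟩
  -- Otherwise the conjugate `A - B t` does not vanish at `P`, so the order is that of the norm.
  have hconj : A.eval (P.chartVal 0) + (-B).eval (P.chartVal 0) * P.chartVal 1 ≠ 0 := by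
    intro h
    rw [eval_neg, neg_mul, ← sub_eq_add_neg, sub_eq_zero] at h
    rw [h, ← two_mul] at h0
    have hB := (mul_eq_zero.1 ((mul_eq_zero.1 h0).resolve_left two_ne_zero)).resolve_right hP
    exact hne (by rw [h, hB, zero_mul]) hB
  have hnorm : A ^ 2 - B ^ 2 * P.chartPoly ≠ 0 := by
    intro h
    have := chartSum_mul_chartSum_neg hf.natDegree_le P A B
    rw [h, map_zero, hunit.mul_right_eq_zero, chartSum_eq_zero_iff] at this
    simp [this] at hconj
  obtain ⟨k, hk⟩ := P.exists_hasOrder_aeval hf hnorm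
  rw [← chartSum_mul_chartSum_neg hf.natDegree_le] at hk
  exact ⟨_, (HasOrder.chartSum hconj).of_mul hk⟩

theorem exists_hasOrder (hf : IsSmoothModel f g) (P : Point f g) {φ : FunField f}
    (hφ : IsUnit φ) : ∃ k, P.HasOrder φ k := by
  obtain ⟨A, B, D, hD, h⟩ := P.exists_mul_aeval_eq_chartSum φ
  obtain ⟨d, A', B', rfl, rfl, hcop⟩ := exists_isCoprime_mul_eq A B
  rw [← aeval_mul_chartSum] at h
  have hunit := h ▸ hφ.mul (P.isUnit_aeval_chartFun_zero hD)
  have hd : d ≠ 0 := by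
    rintro rfl
    simp at hunit
  obtain ⟨k, hk⟩ := P.exists_hasOrder_aeval hf hd
  obtain ⟨l, hl⟩ := P.exists_hasOrder_chartSum hf hcop (isUnit_of_mul_isUnit_right hunit)
  obtain ⟨m, hm⟩ := P.exists_hasOrder_aeval hf hD
  exact ⟨_, hm.of_mul (h ▸ hk.mul hl)⟩

theorem hasOrder_chartFun_zero_sq_sub {P : Point f g} (ht : P.chartVal 1 ≠ 0) :
    P.HasOrder (P.chartFun 0 ^ 2 - algebraMap ℂ (FunField f) (P.chartVal 0 ^ 2))
      (open Classical in if P.chartVal 0 = 0 then 2 else 1) := by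
  have hunif := HasOrder.unif (P := P)
  rw [unif_of_ne_zero ht] at hunif
  split_ifs with hs
  · simpa [hs] using hunif.pow 2
  · have hsum := HasOrder.aeval_chartFun_zero (P := P) (A := X + C (P.chartVal 0))
      (by simpa [← two_mul] using hs)
    rw [map_add, aeval_X, aeval_C] at hsum
    rw [map_pow, sq_sub_sq, mul_comm]
    exact hunif.mul hsum

section Map

variable {f₁ f₂ : ℂ[X]} {g₁ g₂ : ℕ} {P : Point f₂ g₂} {Q : Point f₁ g₁}
  {Φ : FunField f₁ →ₐ[ℂ] FunField f₂} {φ : FunField f₁} {k : ℤ}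

theorem HasOrder.map (h : Q.HasOrder φ k) {e : ℤ} (ρ : Fin 2 → MvPolynomial (Fin 2) ℂ)
    (hfun : ∀ i, Φ (Q.chartFun i) = MvPolynomial.aeval P.chartFun (ρ i))
    (hval : ∀ i, Q.chartVal i = MvPolynomial.eval P.chartVal (ρ i))
    (hunif : P.HasOrder (Φ Q.unif) e) : P.HasOrder (Φ φ) (e * k) := by
  obtain ⟨m, n, p, q, rfl, hp, hq, heq⟩ := h
  have hΦ (r : MvPolynomial (Fin 2) ℂ) : Φ (MvPolynomial.aeval Q.chartFun r) =
      MvPolynomial.aeval P.chartFun (MvPolynomial.bind₁ ρ r) := by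
    rw [MvPolynomial.aeval_bind₁, ← AlgHom.comp_apply, MvPolynomial.comp_aeval]
    simp only [hfun]
  have heval (r : MvPolynomial (Fin 2) ℂ) :
      MvPolynomial.eval P.chartVal (MvPolynomial.bind₁ ρ r) = MvPolynomial.eval Q.chartVal r := by
    rw [funext hval]
    exact MvPolynomial.aeval_bind₁ P.chartVal ρ r
  have hunit {r : MvPolynomial (Fin 2) ℂ} (hr : MvPolynomial.eval Q.chartVal r ≠ 0) :
      P.HasOrder (Φ (MvPolynomial.aeval Q.chartFun r)) 0 := by
    rw [hΦ]
    exact HasOrder.aeval (by rwa [heval])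
  have hmul := (hunit hp).mul (hunif.pow m)
  rw [← map_pow, ← map_mul, ← heq, map_mul, map_mul, map_pow] at hmul
  convert (hunit hq).of_mul ((hunif.pow n).of_mul hmul) using 1
  ring

theorem HasOrder.map_of_sq (h : Q.HasOrder φ k) (hfun₀ : Φ (Q.chartFun 0) = P.chartFun 0 ^ 2)
    (hfun₁ : Φ (Q.chartFun 1) = P.chartFun 1) (hval₀ : Q.chartVal 0 = P.chartVal 0 ^ 2)
    (hval₁ : Q.chartVal 1 = P.chartVal 1) (hne : P.chartVal 1 = 0 → P.chartVal 0 ≠ 0) :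
    P.HasOrder (Φ φ) ((open Classical in if P.chartVal 0 = 0 then 2 else 1) * k) := by
  refine h.map ![MvPolynomial.X 0 ^ 2, MvPolynomial.X 1]
    (Fin.forall_fin_two.2 ⟨by simp [hfun₀], by simp [hfun₁]⟩)
    (Fin.forall_fin_two.2 ⟨by simp [hval₀], by simp [hval₁]⟩) ?_
  by_cases ht : P.chartVal 1 = 0
  · rw [unif_of_eq_zero (hval₁.trans ht), hfun₁, ← unif_of_eq_zero ht, if_neg (hne ht)]
    exact HasOrder.unif
  · rw [unif_of_ne_zero (hval₁.trans_ne ht), map_sub, hfun₀, hval₀, Φ.commutes]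
    exact hasOrder_chartFun_zero_sq_sub ht

theorem HasOrder.map_of_sq_of_mul (h : Q.HasOrder φ k)
    (hfun₀ : Φ (Q.chartFun 0) = P.chartFun 0 ^ 2)
    (hfun₁ : Φ (Q.chartFun 1) = P.chartFun 0 * P.chartFun 1)
    (hval₀ : Q.chartVal 0 = P.chartVal 0 ^ 2)
    (hval₁ : Q.chartVal 1 = P.chartVal 0 * P.chartVal 1)
    (hne : P.chartVal 1 = 0 → P.chartVal 0 ≠ 0) : P.HasOrder (Φ φ) k := by
  rw [← one_mul k]
  refine h.map ![MvPolynomial.X 0 ^ 2, MvPolynomial.X 0 * MvPolynomial.X 1]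
    (Fin.forall_fin_two.2 ⟨by simp [hfun₀], by simp [hfun₁]⟩)
    (Fin.forall_fin_two.2 ⟨by simp [hval₀], by simp [hval₁]⟩) ?_
  have hunif := HasOrder.unif (P := P)
  by_cases ht : P.chartVal 1 = 0
  · rw [unif_of_eq_zero (by rw [hval₁, ht, mul_zero]), hfun₁, ← unif_of_eq_zero ht]
    simpa using (HasOrder.aeval (P := P) (p := MvPolynomial.X 0) (by simpa using hne ht)).mul hunif
  by_cases hs : P.chartVal 0 = 0
  · rw [unif_of_ne_zero ht, hs, map_zero, sub_zero] at hunif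
    rw [unif_of_eq_zero (by rw [hval₁, hs, zero_mul]), hfun₁]
    simpa using hunif.mul (HasOrder.aeval (P := P) (p := MvPolynomial.X 1) (by simpa using ht))
  · rw [unif_of_ne_zero (by rw [hval₁]; exact mul_ne_zero hs ht), map_sub, hfun₀, hval₀,
      Φ.commutes]
    simpa [hs] using hasOrder_chartFun_zero_sq_sub ht

theorem HasOrder.map_of_const_mul (h : Q.HasOrder φ k) {δ : Fin 2 → ℂ} (hδ : ∀ i, δ i ≠ 0)
    (hfun : ∀ i, Φ (Q.chartFun i) = algebraMap ℂ (FunField f₂) (δ i) * P.chartFun i)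
    (hval : ∀ i, Q.chartVal i = δ i * P.chartVal i) : P.HasOrder (Φ φ) k := by
  have hconst (i : Fin 2) : P.HasOrder (algebraMap ℂ (FunField f₂) (δ i) * P.unif) 1 := by
    simpa using (HasOrder.aeval (P := P) (p := MvPolynomial.C (δ i)) (by simpa using hδ i)).mul
      HasOrder.unif
  rw [← one_mul k]
  refine h.map (fun i => MvPolynomial.C (δ i) * MvPolynomial.X i)
    (fun i => by simp [hfun]) (fun i => by simp [hval]) ?_
  by_cases ht : P.chartVal 1 = 0
  · rw [unif_of_eq_zero (by rw [hval, ht, mul_zero]), hfun, ← unif_of_eq_zero ht]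
    exact hconst 1
  · rw [unif_of_ne_zero (by rw [hval]; exact mul_ne_zero (hδ 1) ht), map_sub, hfun, hval,
      Φ.commutes, map_mul, ← mul_sub, ← unif_of_ne_zero ht]
    exact hconst 0

end Map

end Point

section Class

variable {f : ℂ[X]} {g : ℕ}

namespace Point

theorem isOrbitMap_xMap : IsOrbitMap (xMap : Point f g → OnePoint ℂ) invol where
  surjective z := by
    induction z using OnePoint.rec with
    | infty =>
      obtain ⟨b, hb⟩ := IsAlgClosed.exists_pow_nat_eq (f.coeff (2 * g + 2)) two_pos
      exact ⟨infty b hb, rfl⟩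
    | coe a =>
      obtain ⟨b, hb⟩ := IsAlgClosed.exists_pow_nat_eq (f.eval a) two_pos
      exact ⟨affine a b hb, rfl⟩
  apply_eq_apply_iff P Q := by
    rcases P with ⟨a, b, h⟩ | ⟨b, h⟩ <;> rcases Q with ⟨c, d, h'⟩ | ⟨d, h'⟩ <;>
      simp only [xMap, invol, OnePoint.coe_eq_coe, OnePoint.coe_ne_infty, OnePoint.infty_ne_coe,
        affine.injEq, infty.injEq, reduceCtorEq, or_self, true_iff]
    · rw [← and_or_left, eq_comm, iff_self_and, ← sq_eq_sq_iff_eq_or_eq_neg]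
      rintro rfl
      rw [h, h']
    · rw [← sq_eq_sq_iff_eq_or_eq_neg, h, h']

theorem orbitDivisor_affine_sub_orbitDivisor_infty_mem_principal (hf : IsSmoothModel f g)
    {a b d : ℂ} (h : b ^ 2 = f.eval a) (h' : d ^ 2 = f.coeff (2 * g + 2)) :
    orbitDivisor invol (affine a b h) - orbitDivisor invol (infty d h') ∈ principal f g := by
  classical
  refine ⟨algebraMap (RatFunc ℂ) _ (algebraMap ℂ[X] _ (X - C a)),
    (isUnit_iff_ne_zero.2 (RatFunc.algebraMap_ne_zero (X_sub_C_ne_zero a))).map _, fun R => ?_⟩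
  rw [Finsupp.sub_apply, isOrbitMap_xMap.orbitDivisor_apply, isOrbitMap_xMap.orbitDivisor_apply]
  rcases R with ⟨c, e, hR⟩ | ⟨e, hR⟩
  · have hx : algebraMap (RatFunc ℂ) (FunField f) (algebraMap ℂ[X] _ (X - C a)) =
        aeval ((affine c e hR : Point f g).chartFun 0) (X - C a) := by
      rw [aeval_chartFun_zero, base, RatFunc.aeval_X_left_eq_algebraMap]
    have hinfty : (infty d h').xMap ≠ (affine c e hR : Point f g).xMap := OnePoint.infty_ne_coe c
    rw [if_neg hinfty, sub_zero, hx]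
    split_ifs with hac
    · obtain rfl : a = c := by simpa [xMap] using hac
      simpa [chartVal] using hasOrder_chartFun_zero_sub hf (affine a e hR : Point f g)
    · exact HasOrder.aeval_chartFun_zero
        (by simpa [chartVal, sub_eq_zero, xMap, eq_comm] using hac)
  · have hx : algebraMap (RatFunc ℂ) (FunField f) (algebraMap ℂ[X] _ (X - C a)) *
        (infty e hR : Point f g).chartFun 0 =
          aeval ((infty e hR : Point f g).chartFun 0) (1 - C a * X) := by
      rw [aeval_chartFun_zero, chartFun_zero, ← map_mul]
      congr 1
      simp [base, sub_mul, RatFunc.X_ne_zero, ← RatFunc.algebraMap_eq_C]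
    have hinfty : (infty d h' : Point f g).xMap = (infty e hR : Point f g).xMap := rfl
    have hne : (affine a b h : Point f g).xMap ≠ (infty e hR : Point f g).xMap :=
      OnePoint.coe_ne_infty a
    rw [if_neg hne, if_pos hinfty]
    have hs := hasOrder_chartFun_zero_sub hf (infty e hR : Point f g)
    have hunit := HasOrder.aeval_chartFun_zero (P := (infty e hR : Point f g))
      (A := 1 - C a * X) (by simp [chartVal])
    rw [← hx, ← sub_zero (chartFun _ _), ← map_zero (algebraMap ℂ (FunField f))] at hunit
    simpa only [zero_sub] using hs.of_mul hunit

theorem orbitDivisor_sub_orbitDivisor_mem_principal (hf : IsSmoothModel f g) (P Q : Point f g) :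
    orbitDivisor invol P - orbitDivisor invol Q ∈ principal f g := by
  obtain ⟨d, hd⟩ := IsAlgClosed.exists_pow_nat_eq (f.coeff (2 * g + 2)) two_pos
  have hinfty (R : Point f g) :
      orbitDivisor invol R - orbitDivisor invol (infty d hd) ∈ principal f g := by
    rcases R with ⟨a, b, h⟩ | ⟨b, h⟩
    · exact orbitDivisor_affine_sub_orbitDivisor_infty_mem_principal hf h hd
    · convert zero_mem (principal f g)
      ext R
      rw [Finsupp.sub_apply, isOrbitMap_xMap.orbitDivisor_apply,
        isOrbitMap_xMap.orbitDivisor_apply]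
      exact sub_self _
  simpa using sub_mem (hinfty P) (hinfty Q)

end Point

/-- The group of divisors up to linear equivalence and torsion. -/
abbrev ClassModTorsion (f : ℂ[X]) (g : ℕ) : Type :=
  ((Point f g →₀ ℤ) ⧸ principal f g) ⧸
    AddCommGroup.torsion ((Point f g →₀ ℤ) ⧸ principal f g)

/-- The class of a divisor up to linear equivalence and torsion. -/
def classModTorsion (f : ℂ[X]) (g : ℕ) : (Point f g →₀ ℤ) →+ ClassModTorsion f g :=
  (QuotientAddGroup.mk' _).comp (QuotientAddGroup.mk' _)

theorem classModTorsion_eq_zero_iff {D : Point f g →₀ ℤ} :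
    classModTorsion f g D = 0 ↔ ∃ n : ℕ, 0 < n ∧ n • D ∈ principal f g := by
  refine (QuotientAddGroup.eq_zero_iff _).trans ?_
  rw [AddCommGroup.mem_torsion, isOfFinAddOrder_iff_nsmul_eq_zero]
  refine exists_congr fun n => and_congr_right fun _ => ?_
  rw [← map_nsmul]
  exact QuotientAddGroup.eq_zero_iff _

theorem classModTorsion_eq_zero {D : Point f g →₀ ℤ} (hD : D ∈ principal f g) :
    classModTorsion f g D = 0 :=
  classModTorsion_eq_zero_iff.2 ⟨1, one_pos, by rwa [one_smul]⟩

/-- The class of a point up to linear equivalence and torsion. Torsion packets are the fibres of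
this map. -/
def pointClass (P : Point f g) : ClassModTorsion f g :=
  classModTorsion f g (Finsupp.single P 1)

theorem pointClass_eq_pointClass_iff {P Q : Point f g} :
    pointClass P = pointClass Q ↔
      classModTorsion f g (Finsupp.single P 1 - Finsupp.single Q 1) = 0 := by
  rw [map_sub, sub_eq_zero, pointClass, pointClass]

theorem isOfFinAddOrder_diff_iff {P Q : Point f g} :
    IsOfFinAddOrder (diff P Q) ↔ pointClass P = pointClass Q := by
  rw [pointClass_eq_pointClass_iff, classModTorsion_eq_zero_iff,
    isOfFinAddOrder_iff_nsmul_eq_zero]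
  refine exists_congr fun n => and_congr_right fun _ => ?_
  rw [diff, ← QuotientAddGroup.mk_nsmul, QuotientAddGroup.eq_zero_iff,
    AddSubgroup.mem_addSubgroupOf]
  rfl

theorem pointClass_add_pointClass_invol (hf : IsSmoothModel f g) (P Q : Point f g) :
    pointClass P + pointClass P.invol = pointClass Q + pointClass Q.invol := by
  have := classModTorsion_eq_zero (Point.orbitDivisor_sub_orbitDivisor_mem_principal hf P Q)
  rwa [map_sub, sub_eq_zero, orbitDivisor, orbitDivisor, map_add, map_add] at this

theorem pointClass_eq_of_mem_ramification (hf : IsSmoothModel f g) {P Q : Point f g}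
    (hP : P ∈ Point.ramification f g) (hQ : Q ∈ Point.ramification f g) :
    pointClass P = pointClass Q := by
  have := pointClass_add_pointClass_invol hf P Q
  rw [show P.invol = P from hP, show Q.invol = Q from hQ, ← two_nsmul, ← two_nsmul] at this
  exact nsmul_right_injective two_ne_zero this

theorem pointClass_invol (hf : IsSmoothModel f g) {P O : Point f g}
    (hO : O ∈ Point.ramification f g) (h : pointClass P = pointClass O) :
    pointClass P.invol = pointClass O := by
  have := pointClass_add_pointClass_invol hf P O
  rwa [h, show O.invol = O from hO, add_right_inj] at this

theorem isHyperellipticTorsionPacket_iff (hf : IsSmoothModel f g) {W : Point f g}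
    (hW : W ∈ Point.ramification f g) {T : Set (Point f g)} :
    IsHyperellipticTorsionPacket T ↔ T = {P | pointClass P = pointClass W} := by
  simp only [IsHyperellipticTorsionPacket, IsTorsionPacket, isOfFinAddOrder_diff_iff]
  have hfiber : ∀ P ∈ {P | pointClass P = pointClass W}, ∀ Q ∈ {P | pointClass P = pointClass W},
      pointClass P = pointClass Q := fun P hP Q hQ => Eq.trans hP (Eq.symm hQ)
  constructor
  · rintro ⟨hT, hram⟩
    exact hT.eq_of_subset hfiber fun P hP => hT.prop P hP W (hram hW)
  · rintro rfl
    exact ⟨⟨hfiber, fun T hT hle P hP => hT P hP W (hle rfl)⟩,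
      fun P hP => pointClass_eq_of_mem_ramification hf hP hW⟩

theorem xMap_mem_image_torsionPoints_iff {f : ℂ[X]} (hf : IsSmoothModel f 1) {P O : Point f 1}
    (hO : O ∈ Point.ramification f 1) :
    P.xMap ∈ Point.xMap '' torsionPoints O ↔ pointClass P = pointClass O := by
  refine ⟨?_, fun h => ⟨P, isOfFinAddOrder_diff_iff.2 h, rfl⟩⟩
  rintro ⟨Q, hQ, hQP⟩
  rcases (Point.isOrbitMap_xMap.apply_eq_apply_iff Q P).1 hQP with rfl | rfl
  · exact isOfFinAddOrder_diff_iff.1 hQ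
  · exact pointClass_invol hf hO (isOfFinAddOrder_diff_iff.1 hQ)

end Class

section Quotient

variable {f₁ f₂ : ℂ[X]} {g₁ g₂ : ℕ}

/-- The map `q` is the quotient of the curve `y² = f₂(x)` by the involution `τ`, the curve
`y² = f₁(x)` being the target; `Φ` and `S` are the pullbacks of functions along `q` and `τ`. -/
structure IsInvolutionQuotient (q : Point f₂ g₂ → Point f₁ g₁) (τ : Point f₂ g₂ → Point f₂ g₂)
    (Φ : FunField f₁ →ₐ[ℂ] FunField f₂) (S : FunField f₂ →ₐ[ℂ] FunField f₂) : Prop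
    extends IsOrbitMap q τ where
  hasOrder_quotient {R : Point f₂ g₂} {φ : FunField f₁} {k : ℤ} :
    (q R).HasOrder φ k → R.HasOrder (Φ φ) (ramificationIndex τ R * k)
  hasOrder_involution {R : Point f₂ g₂} {φ : FunField f₂} {k : ℤ} :
    (τ R).HasOrder φ k → R.HasOrder (S φ) k
  isLocalHom : IsLocalHom Φ
  apply_apply_eq (φ : FunField f₂) : S (S φ) = φ
  exists_apply_eq {φ : FunField f₂} : S φ = φ → ∃ ψ, Φ ψ = φ

namespace IsInvolutionQuotient

variable {q : Point f₂ g₂ → Point f₁ g₁} {τ : Point f₂ g₂ → Point f₂ g₂}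
  {Φ : FunField f₁ →ₐ[ℂ] FunField f₂} {S : FunField f₂ →ₐ[ℂ] FunField f₂}
  {D : Point f₂ g₂ →₀ ℤ}

theorem add_mapDomain_mem_principal (h : IsInvolutionQuotient q τ Φ S)
    (hD : D.mapDomain q ∈ principal f₁ g₁) : D + D.mapDomain τ ∈ principal f₂ g₂ := by
  obtain ⟨φ, hφ, ho⟩ := hD
  refine ⟨Φ φ, hφ.map Φ, fun R => ?_⟩
  rw [← h.ramificationIndex_mul_mapDomain]
  exact h.hasOrder_quotient (ho (q R))

theorem mapDomain_mem_principal (h : IsInvolutionQuotient q τ Φ S) (hf₁ : IsSmoothModel f₁ g₁)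
    (hf₂ : IsSmoothModel f₂ g₂) (hD : D ∈ principal f₂ g₂) :
    D.mapDomain q ∈ principal f₁ g₁ := by
  obtain ⟨φ, hφ, ho⟩ := hD
  obtain ⟨ψ, hψ⟩ := h.exists_apply_eq (φ := φ * S φ) (by
    rw [map_mul, h.apply_apply_eq, mul_comm])
  have hunit : IsUnit ψ := h.isLocalHom.map_nonunit ψ (hψ ▸ hφ.mul (hφ.map S))
  refine ⟨ψ, hunit, fun Q => ?_⟩
  obtain ⟨R, rfl⟩ := h.surjective Q
  obtain ⟨k, hk⟩ := (q R).exists_hasOrder hf₁ hunit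
  have hnorm := (ho R).mul (h.hasOrder_involution (ho (τ R)))
  rw [← hψ] at hnorm
  have hD : D.mapDomain τ R = D (τ R) := by
    conv_lhs => rw [← h.involutive R, Finsupp.mapDomain_apply h.involutive.injective]
  have hRk : ramificationIndex τ R * D.mapDomain q (q R) = ramificationIndex τ R * k := by
    rw [h.ramificationIndex_mul_mapDomain, Finsupp.add_apply, hD]
    exact hnorm.unique hf₂ (h.hasOrder_quotient hk)
  rwa [mul_left_cancel₀ (ramificationIndex_ne_zero τ R) hRk]

theorem pointClass_add_pointClass_involution (h : IsInvolutionQuotient q τ Φ S)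
    {P W : Point f₂ g₂} (hPW : pointClass (q P) = pointClass (q W)) :
    pointClass P + pointClass (τ P) = pointClass W + pointClass (τ W) := by
  obtain ⟨n, hn, hmem⟩ :=
    classModTorsion_eq_zero_iff.1 (pointClass_eq_pointClass_iff.1 hPW)
  have hadd := h.add_mapDomain_mem_principal (D := n • (Finsupp.single P 1 - Finsupp.single W 1))
    (by simpa [Finsupp.mapDomain_smul, Finsupp.mapDomain_sub] using hmem)
  rw [Finsupp.mapDomain_smul, ← smul_add, Finsupp.mapDomain_sub, Finsupp.mapDomain_single,
    Finsupp.mapDomain_single] at hadd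
  have := classModTorsion_eq_zero_iff.2 ⟨n, hn, hadd⟩
  rwa [sub_add_sub_comm, map_sub, sub_eq_zero, map_add, map_add] at this

theorem pointClass_apply_eq (h : IsInvolutionQuotient q τ Φ S) (hf₁ : IsSmoothModel f₁ g₁)
    (hf₂ : IsSmoothModel f₂ g₂) {P W : Point f₂ g₂} (hPW : pointClass P = pointClass W) :
    pointClass (q P) = pointClass (q W) := by
  obtain ⟨n, hn, hmem⟩ :=
    classModTorsion_eq_zero_iff.1 (pointClass_eq_pointClass_iff.1 hPW)
  have := h.mapDomain_mem_principal hf₁ hf₂ hmem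
  rw [Finsupp.mapDomain_smul, Finsupp.mapDomain_sub, Finsupp.mapDomain_single,
    Finsupp.mapDomain_single] at this
  exact pointClass_eq_pointClass_iff.2 (classModTorsion_eq_zero_iff.2 ⟨n, hn, this⟩)

theorem pointClass_eq_iff {f₁' : ℂ[X]} {g₁' : ℕ} {q' : Point f₂ g₂ → Point f₁' g₁'}
    {τ' : Point f₂ g₂ → Point f₂ g₂} {Φ' : FunField f₁' →ₐ[ℂ] FunField f₂}
    {S' : FunField f₂ →ₐ[ℂ] FunField f₂} (h : IsInvolutionQuotient q τ Φ S)
    (h' : IsInvolutionQuotient q' τ' Φ' S') (hτ : ∀ P, τ' P = (τ P).invol)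
    (hf₁ : IsSmoothModel f₁ g₁) (hf₁' : IsSmoothModel f₁' g₁') (hf₂ : IsSmoothModel f₂ g₂)
    {P W : Point f₂ g₂} :
    pointClass P = pointClass W ↔
      pointClass (q P) = pointClass (q W) ∧ pointClass (q' P) = pointClass (q' W) := by
  refine ⟨fun hPW => ⟨h.pointClass_apply_eq hf₁ hf₂ hPW, h'.pointClass_apply_eq hf₁' hf₂ hPW⟩,
    fun ⟨hq, hq'⟩ => nsmul_right_injective two_ne_zero ?_⟩
  have hsum := h.pointClass_add_pointClass_involution hq
  have hsum' := h'.pointClass_add_pointClass_involution hq'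
  have hinvol := pointClass_add_pointClass_invol hf₂ (τ P) (τ W)
  rw [hτ, hτ] at hsum'
  calc 2 • pointClass P
      = (pointClass P + pointClass (τ P)) + (pointClass P + pointClass (τ P).invol) -
          (pointClass (τ P) + pointClass (τ P).invol) := by abel
    _ = (pointClass W + pointClass (τ W)) + (pointClass W + pointClass (τ W).invol) -
          (pointClass (τ W) + pointClass (τ W).invol) := by rw [hsum, hsum', hinvol]
    _ = 2 • pointClass W := by abel

end IsInvolutionQuotient

end Quotient

section Pullback

variable {f₁ f₂ : ℂ[X]} {g₁ : ℕ} {r c : ℂ[X]}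

theorem algebraMap_sq_mul_eq_ratFuncComp (hr : 0 < r.natDegree) (h : c ^ 2 * f₂ = f₁.comp r) :
    algebraMap ℂ[X] (RatFunc ℂ) c ^ 2 * algebraMap ℂ[X] (RatFunc ℂ) f₂ =
      ratFuncComp r hr (algebraMap ℂ[X] (RatFunc ℂ) f₁) := by
  rw [ratFuncComp_algebraMap, ← h, map_mul, map_pow]

variable (hr : 0 < r.natDegree) (h : c ^ 2 * f₂ = f₁.comp r)

/-- The pullback of functions along the map `(x, y) ↦ (r(x), c(x) y)` from `y² = f₂(x)` to
`y² = f₁(x)`. -/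
def pullback : FunField f₁ →ₐ[ℂ] FunField f₂ :=
  quadraticMap (ratFuncComp r hr) (algebraMap_sq_mul_eq_ratFuncComp hr h)

theorem pullback_chartFun_zero (Q : Point f₁ g₁) :
    pullback hr h (Q.chartFun 0) = algebraMap (RatFunc ℂ) (FunField f₂)
      (ratFuncComp r hr Q.base) := by
  rw [Point.chartFun_zero, pullback, quadraticMap_algebraMap]

theorem pullback_chartFun_one (Q : Point f₁ g₁) :
    pullback hr h (Q.chartFun 1) = algebraMap (RatFunc ℂ) (FunField f₂)
      (ratFuncComp r hr Q.scale * algebraMap ℂ[X] (RatFunc ℂ) c) * omega := by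
  rw [Point.chartFun_one, pullback, map_mul, quadraticMap_algebraMap, quadraticMap_omega,
    map_mul, mul_assoc]

theorem isLocalHom_pullback : IsLocalHom (pullback hr h) :=
  isLocalHom_quadraticMap _ _

end Pullback

namespace Point

variable {f : ℂ[X]} {g : ℕ}

/-- The map `(x, y) ↦ (-x, ε y)`, where `ε = ±1`, on the curve `y² = f(x)` for an even polynomial
`f`. At infinity, `ε y / (-x)^(g+1) = (-1)^(g+1) ε (y / x^(g+1))`. -/
def negX (hf : f.comp (-X) = f) {ε : ℂ} (hε : ε ^ 2 = 1) : Point f g → Point f g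
  | affine a b h => affine (-a) (ε * b) (by
      rw [mul_pow, hε, one_mul, h, ← congrArg (eval (-a)) hf]; simp)
  | infty b h => infty ((-1) ^ (g + 1) * ε * b) (by
      rw [mul_pow, mul_pow, hε, ← pow_mul, mul_comm (g + 1), pow_mul, neg_one_sq, one_pow,
        one_mul, one_mul, h])

theorem C_sq_mul_eq_comp_neg_X (hf : f.comp (-X) = f) {ε : ℂ} (hε : ε ^ 2 = 1) :
    C ε ^ 2 * f = f.comp (-X) := by
  rw [hf, ← map_pow, hε, map_one, one_mul]

theorem hasOrder_pullback_negX (hf : f.comp (-X) = f) {ε : ℂ} (hε : ε ^ 2 = 1) {P : Point f g}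
    {φ : FunField f} {k : ℤ} (hφ : (negX hf hε P).HasOrder φ k) :
    P.HasOrder (pullback natDegree_neg_X_pos (C_sq_mul_eq_comp_neg_X hf hε) φ) k := by
  have hε0 : ε ≠ 0 := by rintro rfl; norm_num at hε
  have hC (δ : ℂ) : algebraMap ℂ (FunField f) δ =
      algebraMap (RatFunc ℂ) (FunField f) (RatFunc.C δ) := rfl
  rcases P with ⟨a, b, h⟩ | ⟨b, h⟩
  · refine hφ.map_of_const_mul (δ := ![-1, ε]) (Fin.forall_fin_two.2 ⟨by simp, by simpa⟩)
      (Fin.forall_fin_two.2 ⟨?_, ?_⟩)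
      (Fin.forall_fin_two.2 ⟨by simp [negX, chartVal], by simp [negX, chartVal]⟩)
    · rw [pullback_chartFun_zero, chartFun_zero, hC, ← map_mul]
      simp [negX, base, ratFuncComp_X]
    · rw [pullback_chartFun_one, chartFun_one, hC, ← mul_assoc, ← map_mul]
      simp [negX, scale]
  · refine hφ.map_of_const_mul (δ := ![-1, (-1) ^ (g + 1) * ε])
      (Fin.forall_fin_two.2 ⟨by simp, by simpa⟩)
      (Fin.forall_fin_two.2 ⟨?_, ?_⟩)
      (Fin.forall_fin_two.2 ⟨by simp [negX, chartVal], by simp [negX, chartVal]⟩)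
    · rw [pullback_chartFun_zero, chartFun_zero, hC, ← map_mul]
      simp [negX, base, ratFuncComp_X]
    · rw [pullback_chartFun_one, chartFun_one, hC, ← mul_assoc, ← map_mul]
      congr 2
      simp only [negX, scale, map_pow, map_inv₀, ratFuncComp_X, map_neg, map_mul, map_one,
        RatFunc.algebraMap_X, RatFunc.algebraMap_C, Matrix.cons_val_one, Matrix.cons_val_fin_one]
      ring

theorem negX_neg (hf : f.comp (-X) = f) {ε : ℂ} (hε : ε ^ 2 = 1) (P : Point f g) :
    negX hf ((neg_sq ε).trans hε) P = (negX hf hε P).invol := by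
  cases P <;> simp [negX, invol]

end Point

section Curves

variable {u v w : ℂ}

theorem polyC_comp_neg_X : (polyC u v w).comp (-X) = polyC u v w := by
  simp [polyC]

theorem polyC_eq_comp : polyC u v w = (polyE u v w).comp (X ^ 2) := by
  simp [polyC, polyE]

theorem one_sq_mul_polyC_eq_comp : 1 ^ 2 * polyC u v w = (polyE u v w).comp (X ^ 2) := by
  rw [one_pow, one_mul, polyC_eq_comp]

theorem X_sq_mul_polyC_eq_comp : X ^ 2 * polyC u v w = (polyE' u v w).comp (X ^ 2) := by
  simp [polyC, polyE']
  ring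

theorem polyE'_eq_X_mul : polyE' u v w = X * polyE u v w := by
  simp only [polyE', polyE, mul_assoc]

theorem polyE_eval_zero_ne_zero (hu : u ≠ 0) (hv : v ≠ 0) (hw : w ≠ 0) :
    (polyE u v w).eval 0 ≠ 0 := by
  simp [polyE, hu, hv, hw]

theorem separable_polyE (huv : u ≠ v) (huw : u ≠ w) (hvw : v ≠ w) : (polyE u v w).Separable := by
  have hcop {a b : ℂ} (hab : a ≠ b) : IsCoprime (X - C a) (X - C b) :=
    isCoprime_X_sub_C_of_isUnit_sub (sub_ne_zero.2 hab).isUnit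
  exact (separable_X_sub_C.mul separable_X_sub_C (hcop huv)).mul separable_X_sub_C
    ((hcop huw).mul_left (hcop hvw))

theorem isSmoothModel_polyE (huv : u ≠ v) (huw : u ≠ w) (hvw : v ≠ w) :
    IsSmoothModel (polyE u v w) 1 where
  separable := separable_polyE huv huw hvw
  natDegree_eq := .inl (by unfold polyE; compute_degree!)

theorem isSmoothModel_polyE' (hu : u ≠ 0) (hv : v ≠ 0) (hw : w ≠ 0) (huv : u ≠ v) (huw : u ≠ w)
    (hvw : v ≠ w) : IsSmoothModel (polyE' u v w) 1 where
  separable := by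
    have hX : IsCoprime X (polyE u v w) := irreducible_X.coprime_iff_not_dvd.2 (by
      rw [X_dvd_iff, coeff_zero_eq_eval_zero]
      exact polyE_eval_zero_ne_zero hu hv hw)
    rw [polyE'_eq_X_mul]
    exact separable_X.mul (separable_polyE huv huw hvw) hX
  natDegree_eq := .inr (by unfold polyE'; compute_degree!)

theorem isSmoothModel_polyC (hu : u ≠ 0) (hv : v ≠ 0) (hw : w ≠ 0) (huv : u ≠ v) (huw : u ≠ w)
    (hvw : v ≠ w) : IsSmoothModel (polyC u v w) 2 where
  separable := by
    rw [polyC_eq_comp]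
    exact separable_comp_X_pow (separable_polyE huv huw hvw)
      (by rw [coeff_zero_eq_eval_zero]; exact polyE_eval_zero_ne_zero hu hv hw) (by norm_num)
  natDegree_eq := .inr (by unfold polyC; compute_degree!)

theorem chartVal_zero_ne_zero_of_chartVal_one_eq_zero (hu : u ≠ 0) (hv : v ≠ 0) (hw : w ≠ 0)
    {P : Point (polyC u v w) 2} (hP : P.chartVal 1 = 0) : P.chartVal 0 ≠ 0 := by
  intro h0
  rcases P with ⟨a, b, h⟩ | ⟨b, h⟩
  · obtain rfl : a = 0 := h0
    obtain rfl : b = 0 := hP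
    simp [polyC, hu, hv, hw] at h
  · obtain rfl : b = 0 := hP
    simp [coeff_polyC] at h

theorem isOrbitMap_psi : IsOrbitMap (psi (u := u) (v := v) (w := w))
    (Point.negX polyC_comp_neg_X (one_pow 2)) where
  surjective Q := by
    rcases Q with ⟨a, b, h⟩ | ⟨b, h⟩
    · obtain ⟨c, rfl⟩ := IsAlgClosed.exists_pow_nat_eq a two_pos
      exact ⟨.affine c b (by simpa [polyE, polyC] using h), rfl⟩
    · obtain rfl : b = 0 := by simpa [coeff_polyE] using h
      exact ⟨.infty 1 (by rw [coeff_polyC, one_pow]), rfl⟩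
  apply_eq_apply_iff P Q := by
    rcases P with ⟨a, b, h⟩ | ⟨b, h⟩ <;> rcases Q with ⟨c, d, h'⟩ | ⟨d, h'⟩ <;>
      simp only [psi, Point.negX, Point.affine.injEq, Point.infty.injEq, reduceCtorEq, or_self,
        true_iff]
    · rw [one_mul, ← or_and_right, ← sq_eq_sq_iff_eq_or_eq_neg, eq_comm, eq_comm (a := b)]
    · rw [coeff_polyC] at h h'
      rw [pow_succ, neg_one_sq, one_mul, mul_one, neg_one_mul, ← sq_eq_sq_iff_eq_or_eq_neg, h, h']

theorem isOrbitMap_psi' : IsOrbitMap (psi' (u := u) (v := v) (w := w))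
    (Point.negX polyC_comp_neg_X neg_one_sq) where
  surjective Q := by
    rcases Q with ⟨a, b, h⟩ | ⟨b, h⟩
    · obtain ⟨c, rfl⟩ := IsAlgClosed.exists_pow_nat_eq a two_pos
      rcases eq_or_ne c 0 with rfl | hc
      · obtain ⟨d, hd⟩ := IsAlgClosed.exists_pow_nat_eq ((polyC u v w).eval 0) two_pos
        obtain rfl : b = 0 := by simpa [polyE'] using h
        exact ⟨.affine 0 d hd, by simp [psi']⟩
      · refine ⟨.affine c (b / c) ?_, by simp [psi', mul_div_cancel₀ _ hc]⟩
        rw [div_pow, h, div_eq_iff (pow_ne_zero 2 hc)]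
        simp [polyE', polyC]
        ring
    · exact ⟨.infty b (by rw [h, coeff_polyC, coeff_polyE']), rfl⟩
  apply_eq_apply_iff P Q := by
    rcases P with ⟨a, b, h⟩ | ⟨b, h⟩ <;> rcases Q with ⟨c, d, h'⟩ | ⟨d, h'⟩ <;>
      simp only [psi', Point.negX, Point.affine.injEq, Point.infty.injEq, reduceCtorEq, or_self]
    · refine ⟨fun ⟨hac, hbd⟩ => ?_, ?_⟩
      · have hc : c = a ∨ c = -a := sq_eq_sq_iff_eq_or_eq_neg.1 hac.symm
        rcases eq_or_ne a 0 with rfl | ha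
        · obtain rfl : c = 0 := by simpa using hc
          simpa using sq_eq_sq_iff_eq_or_eq_neg.1 (h'.trans h.symm)
        · rcases hc with rfl | rfl
          · exact .inl ⟨rfl, (mul_left_cancel₀ ha hbd).symm⟩
          · exact .inr ⟨rfl, mul_left_cancel₀ ha (by linear_combination hbd)⟩
      · rintro (⟨rfl, rfl⟩ | ⟨rfl, rfl⟩)
        · exact ⟨rfl, rfl⟩
        · exact ⟨(neg_sq a).symm, by ring⟩
    · norm_num [eq_comm]

theorem negX_one_eq_self_iff {P : Point (polyC u v w) 2} :
    Point.negX polyC_comp_neg_X (one_pow 2) P = P ↔ rho P = (0 : ℂ) := by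
  rcases P with ⟨a, b, h⟩ | ⟨b, h⟩
  · simp [Point.negX, rho, psi, Point.xMap, neg_eq_self]
  · rw [coeff_polyC] at h
    have hb : b ≠ 0 := by rintro rfl; norm_num at h
    simpa [Point.negX, rho, psi, Point.xMap, pow_succ, neg_eq_self] using hb

theorem negX_neg_one_eq_self_iff (hu : u ≠ 0) (hv : v ≠ 0) (hw : w ≠ 0)
    {P : Point (polyC u v w) 2} :
    Point.negX polyC_comp_neg_X neg_one_sq P = P ↔ rho P = OnePoint.infty := by
  have hne := chartVal_zero_ne_zero_of_chartVal_one_eq_zero hu hv hw (P := P)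
  rcases P with ⟨a, b, h⟩ | ⟨b, h⟩
  · simpa [Point.negX, rho, psi, Point.xMap, neg_eq_self, Point.chartVal] using fun ha hb =>
      hne hb ha
  · simp [Point.negX, rho, psi, Point.xMap, pow_succ]

theorem hasOrder_pullback_psi (hu : u ≠ 0) (hv : v ≠ 0) (hw : w ≠ 0) {P : Point (polyC u v w) 2}
    {φ : FunField (polyE u v w)} {k : ℤ} (h : (psi P).HasOrder φ k) :
    P.HasOrder (pullback natDegree_X_sq_pos one_sq_mul_polyC_eq_comp φ)
      (ramificationIndex (Point.negX polyC_comp_neg_X (one_pow 2)) P * k) := by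
  have hne := chartVal_zero_ne_zero_of_chartVal_one_eq_zero hu hv hw (P := P)
  rcases P with ⟨a, b, hP⟩ | ⟨b, hP⟩
  · have hram : ramificationIndex (Point.negX polyC_comp_neg_X (one_pow 2))
        (.affine a b hP : Point _ 2) =
        open Classical in if a = 0 then 2 else 1 := by
      simp [ramificationIndex, negX_one_eq_self_iff, rho, psi, Point.xMap]
    rw [hram]
    refine h.map_of_sq ?_ ?_ (by simp [psi, Point.chartVal]) (by simp [psi, Point.chartVal]) hne
    · rw [pullback_chartFun_zero, Point.chartFun_zero, ← map_pow]
      simp [psi, Point.base, ratFuncComp_X]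
    · rw [pullback_chartFun_one, Point.chartFun_one]
      simp [psi, Point.scale]
  · rw [ramificationIndex, if_neg (by simp [negX_one_eq_self_iff, rho, psi, Point.xMap]), one_mul]
    refine h.map_of_sq_of_mul ?_ ?_ (by simp [psi, Point.chartVal])
      (by simp [psi, Point.chartVal]) hne
    · rw [pullback_chartFun_zero, Point.chartFun_zero, ← map_pow]
      simp [psi, Point.base, ratFuncComp_X]
    · rw [pullback_chartFun_one, Point.chartFun_zero, Point.chartFun_one, ← mul_assoc, ← map_mul]
      congr 2
      simp only [psi, Point.scale, Point.base, map_pow, map_inv₀, map_one, ratFuncComp_X,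
        RatFunc.algebraMap_X]
      ring

theorem hasOrder_pullback_psi' (hu : u ≠ 0) (hv : v ≠ 0) (hw : w ≠ 0) {P : Point (polyC u v w) 2}
    {φ : FunField (polyE' u v w)} {k : ℤ} (h : (psi' P).HasOrder φ k) :
    P.HasOrder (pullback natDegree_X_sq_pos X_sq_mul_polyC_eq_comp φ)
      (ramificationIndex (Point.negX polyC_comp_neg_X neg_one_sq) P * k) := by
  have hne := chartVal_zero_ne_zero_of_chartVal_one_eq_zero hu hv hw (P := P)
  rcases P with ⟨a, b, hP⟩ | ⟨b, hP⟩
  · rw [ramificationIndex,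
      if_neg (by simp [negX_neg_one_eq_self_iff hu hv hw, rho, psi, Point.xMap]), one_mul]
    refine h.map_of_sq_of_mul ?_ ?_ (by simp [psi', Point.chartVal])
      (by simp [psi', Point.chartVal]) hne
    · rw [pullback_chartFun_zero, Point.chartFun_zero, ← map_pow]
      simp [psi', Point.base, ratFuncComp_X]
    · rw [pullback_chartFun_one, Point.chartFun_zero, Point.chartFun_one, ← mul_assoc, ← map_mul]
      simp [psi', Point.scale, Point.base]
  · have hram : ramificationIndex (Point.negX polyC_comp_neg_X neg_one_sq)
        (.infty b hP : Point _ 2) =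
        open Classical in if (.infty b hP : Point _ 2).chartVal 0 = 0 then 2 else 1 := by
      simp [ramificationIndex, negX_neg_one_eq_self_iff hu hv hw, rho, psi, Point.xMap,
        Point.chartVal]
    rw [hram]
    refine h.map_of_sq ?_ ?_ (by simp [psi', Point.chartVal])
      (by simp [psi', Point.chartVal]) hne
    · rw [pullback_chartFun_zero, Point.chartFun_zero, ← map_pow]
      simp [psi', Point.base, ratFuncComp_X]
    · rw [pullback_chartFun_one, Point.chartFun_one]
      congr 2
      simp only [psi', Point.scale, map_pow, map_inv₀, ratFuncComp_X, RatFunc.algebraMap_X]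
      rw [← inv_pow, ← pow_mul, show 2 * (1 + 1) = 2 + 1 + 1 from rfl, pow_succ _ (2 + 1),
        mul_assoc, inv_mul_cancel₀ RatFunc.X_ne_zero, mul_one]

theorem isInvolutionQuotient_psi (hu : u ≠ 0) (hv : v ≠ 0) (hw : w ≠ 0) :
    IsInvolutionQuotient (psi (u := u) (v := v) (w := w))
      (Point.negX polyC_comp_neg_X (one_pow 2))
      (pullback natDegree_X_sq_pos one_sq_mul_polyC_eq_comp)
      (pullback natDegree_neg_X_pos
        (Point.C_sq_mul_eq_comp_neg_X polyC_comp_neg_X (one_pow 2))) where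
  toIsOrbitMap := isOrbitMap_psi
  hasOrder_quotient := hasOrder_pullback_psi hu hv hw
  hasOrder_involution := Point.hasOrder_pullback_negX polyC_comp_neg_X (one_pow 2)
  isLocalHom := isLocalHom_pullback _ _
  apply_apply_eq := quadraticMap_quadraticMap_self ratFuncComp_neg_X_ratFuncComp_neg_X _
    (by simp)
  exists_apply_eq := exists_quadraticMap_eq _ _ (fun _ => exists_ratFuncComp_X_sq_eq two_ne_zero)
    (by simp) (by simp)

theorem isInvolutionQuotient_psi' (hu : u ≠ 0) (hv : v ≠ 0) (hw : w ≠ 0) :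
    IsInvolutionQuotient (psi' (u := u) (v := v) (w := w))
      (Point.negX polyC_comp_neg_X neg_one_sq)
      (pullback natDegree_X_sq_pos X_sq_mul_polyC_eq_comp)
      (pullback natDegree_neg_X_pos
        (Point.C_sq_mul_eq_comp_neg_X polyC_comp_neg_X neg_one_sq)) where
  toIsOrbitMap := isOrbitMap_psi'
  hasOrder_quotient := hasOrder_pullback_psi' hu hv hw
  hasOrder_involution := Point.hasOrder_pullback_negX polyC_comp_neg_X neg_one_sq
  isLocalHom := isLocalHom_pullback _ _
  apply_apply_eq := quadraticMap_quadraticMap_self ratFuncComp_neg_X_ratFuncComp_neg_X _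
    (by simp)
  exists_apply_eq := exists_quadraticMap_eq _ _ (fun _ => exists_ratFuncComp_X_sq_eq two_ne_zero)
    (by simp [ratFuncComp_X]) (by simp [RatFunc.X_ne_zero])

end Curves

section TorsionPacket

variable {u v w : ℂ}

theorem psi_mem_ramification {P : Point (polyC u v w) 2}
    (hP : P ∈ Point.ramification (polyC u v w) 2) :
    psi P ∈ Point.ramification (polyE u v w) 1 := by
  have ht : P.chartVal 1 = 0 := Point.invol_eq_self_iff.1 hP
  refine Point.invol_eq_self_iff.2 ?_
  rcases P with ⟨a, b, h⟩ | ⟨b, h⟩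
  · simpa [psi, Point.chartVal] using ht
  · simp [psi, Point.chartVal]

theorem psi'_mem_ramification {P : Point (polyC u v w) 2}
    (hP : P ∈ Point.ramification (polyC u v w) 2) :
    psi' P ∈ Point.ramification (polyE' u v w) 1 := by
  have ht : P.chartVal 1 = 0 := Point.invol_eq_self_iff.1 hP
  refine Point.invol_eq_self_iff.2 ?_
  rcases P with ⟨a, b, h⟩ | ⟨b, h⟩
  · simpa [psi', Point.chartVal] using Or.inr ht
  · simpa [psi', Point.chartVal] using ht

theorem exists_mem_ramification_rho_eq {a : ℂ} (ha : (polyE u v w).eval a = 0) :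
    ∃ P ∈ Point.ramification (polyC u v w) 2, rho P = a := by
  obtain ⟨c, rfl⟩ := IsAlgClosed.exists_pow_nat_eq a two_pos
  exact ⟨.affine c 0 (by simpa [polyC_eq_comp] using ha.symm), Point.invol_eq_self_iff.2 rfl, rfl⟩

theorem rho_mem_commonTorsion_iff (hu : u ≠ 0) (hv : v ≠ 0) (hw : w ≠ 0) (huv : u ≠ v)
    (huw : u ≠ w) (hvw : v ≠ w) {O : Point (polyE u v w) 1}
    (hO : O ∈ Point.ramification (polyE u v w) 1) {O' : Point (polyE' u v w) 1}
    (hO' : O' ∈ Point.ramification (polyE' u v w) 1) {P : Point (polyC u v w) 2} :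
    rho P ∈ commonTorsion O O' ↔
      pointClass (psi P) = pointClass O ∧ pointClass (psi' P) = pointClass O' := by
  refine and_congr (xMap_mem_image_torsionPoints_iff (isSmoothModel_polyE huv huw hvw) hO) ?_
  rw [rho_eq_xMap_psi']
  exact xMap_mem_image_torsionPoints_iff (isSmoothModel_polyE' hu hv hw huv huw hvw) hO'

theorem isHyperellipticTorsionPacket_iff_eq_preimage_rho (hu : u ≠ 0) (hv : v ≠ 0) (hw : w ≠ 0)
    (huv : u ≠ v) (huw : u ≠ w) (hvw : v ≠ w) {O : Point (polyE u v w) 1}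
    (hO : O ∈ Point.ramification (polyE u v w) 1) {O' : Point (polyE' u v w) 1}
    (hO' : O' ∈ Point.ramification (polyE' u v w) 1) {T : Set (Point (polyC u v w) 2)} :
    IsHyperellipticTorsionPacket T ↔ T = rho ⁻¹' commonTorsion O O' := by
  have hE := isSmoothModel_polyE huv huw hvw
  have hE' := isSmoothModel_polyE' hu hv hw huv huw hvw
  have hC := isSmoothModel_polyC hu hv hw huv huw hvw
  obtain ⟨W, hW, -⟩ := exists_mem_ramification_rho_eq (u := u) (v := v) (w := w) (a := u)
    (by simp [polyE])
  have hfibre : {P | pointClass P = pointClass W} = rho ⁻¹' commonTorsion O O' := by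
    ext P
    rw [Set.mem_preimage, rho_mem_commonTorsion_iff hu hv hw huv huw hvw hO hO',
      ← pointClass_eq_of_mem_ramification hE (psi_mem_ramification hW) hO,
      ← pointClass_eq_of_mem_ramification hE' (psi'_mem_ramification hW) hO']
    exact (isInvolutionQuotient_psi hu hv hw).pointClass_eq_iff
      (isInvolutionQuotient_psi' hu hv hw)
      (Point.negX_neg polyC_comp_neg_X (one_pow 2)) hE hE' hC
  rw [isHyperellipticTorsionPacket_iff hC hW, hfibre]

end TorsionPacket

section Counting

variable {u v w : ℂ}

theorem image_xMap_ramification_polyE :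
    Point.xMap '' Point.ramification (polyE u v w) 1 = {↑u, ↑v, ↑w, OnePoint.infty} := by
  ext z
  constructor
  · rintro ⟨⟨a, b, h⟩ | ⟨b, h⟩, hP, rfl⟩
    · obtain rfl : b = 0 := Point.invol_eq_self_iff.1 hP
      simpa [polyE, sub_eq_zero, Point.xMap, or_assoc, eq_comm] using h
    · simp [Point.xMap]
  · have hcoe {a : ℂ} (ha : (polyE u v w).eval a = 0) :
        (a : OnePoint ℂ) ∈ Point.xMap '' Point.ramification (polyE u v w) 1 :=
      ⟨.affine a 0 (by simp [ha]), Point.invol_eq_self_iff.2 rfl, rfl⟩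
    rintro (rfl | rfl | rfl | rfl)
    · exact hcoe (by simp [polyE])
    · exact hcoe (by simp [polyE])
    · exact hcoe (by simp [polyE])
    · exact ⟨.infty 0 (by simp [coeff_polyE]), Point.invol_eq_self_iff.2 rfl, rfl⟩

theorem image_psi_fixedPoints :
    psi '' Function.fixedPoints (Point.negX polyC_comp_neg_X (one_pow 2)) =
      (Point.xMap ⁻¹' {((0 : ℂ) : OnePoint ℂ)} : Set (Point (polyE u v w) 1)) := by
  rw [← Set.image_preimage_eq (Point.xMap ⁻¹' _) isOrbitMap_psi.surjective]
  exact congrArg _ (Set.ext fun _ => negX_one_eq_self_iff)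

theorem encard_preimage_rho_add (hu : u ≠ 0) (hv : v ≠ 0) (hw : w ≠ 0) {I : Set (OnePoint ℂ)} :
    (rho (u := u) (v := v) (w := w) ⁻¹' I).encard +
        2 * (I ∩ {((0 : ℂ) : OnePoint ℂ)}).encard +
        2 * (I ∩ {↑u, ↑v, ↑w, OnePoint.infty}).encard = 4 * I.encard := by
  have hx := (Point.isOrbitMap_xMap (f := polyE u v w) (g := 1)).encard_preimage_add I
  have hx₀ := (Point.isOrbitMap_xMap (f := polyE u v w) (g := 1)).encard_preimage_add
    (I ∩ {((0 : ℂ) : OnePoint ℂ)})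
  have hψ := (isOrbitMap_psi (u := u) (v := v) (w := w)).encard_preimage_add (Point.xMap ⁻¹' I)
  have hbranch : Point.xMap '' Function.fixedPoints Point.invol =
      ({↑u, ↑v, ↑w, OnePoint.infty} : Set (OnePoint ℂ)) := image_xMap_ramification_polyE
  have hzero : I ∩ {((0 : ℂ) : OnePoint ℂ)} ∩ {↑u, ↑v, ↑w, OnePoint.infty} = ∅ := by
    rw [Set.inter_assoc, Set.singleton_inter_eq_empty.2 (by simp [hu.symm, hv.symm, hw.symm]),
      Set.inter_empty]
  rw [hbranch] at hx hx₀
  rw [hzero, Set.encard_empty, add_zero, Set.preimage_inter] at hx₀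
  rw [image_psi_fixedPoints, hx₀] at hψ
  have hρ : rho (u := u) (v := v) (w := w) ⁻¹' I = psi ⁻¹' (Point.xMap ⁻¹' I) :=
    Set.ext fun P => by rw [Set.mem_preimage, Set.mem_preimage, Set.mem_preimage, rho]
  calc
    _ = 2 * ((Point.xMap ⁻¹' I).encard + (I ∩ {↑u, ↑v, ↑w, OnePoint.infty}).encard) := by
      rw [hρ, hψ, mul_add]
    _ = 4 * I.encard := by rw [hx, ← mul_assoc]; norm_num

theorem encard_preimage_rho_of_ramification_subset (hu : u ≠ 0) (hv : v ≠ 0) (hw : w ≠ 0)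
    (huv : u ≠ v) (huw : u ≠ w) (hvw : v ≠ w) {I : Set (OnePoint ℂ)}
    (hI : Point.ramification (polyC u v w) 2 ⊆ rho ⁻¹' I) :
    (rho (u := u) (v := v) (w := w) ⁻¹' I).encard + 6 +
        2 * (I ∩ {((0 : ℂ) : OnePoint ℂ), OnePoint.infty}).encard = 4 * I.encard := by
  have hmem {a : ℂ} (ha : (polyE u v w).eval a = 0) : (a : OnePoint ℂ) ∈ I := by
    obtain ⟨P, hP, hPa⟩ := exists_mem_ramification_rho_eq ha
    exact hPa ▸ hI hP
  have huvw : (I ∩ {↑u, ↑v, ↑w, OnePoint.infty}).encard = 3 + (I ∩ {OnePoint.infty}).encard := by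
    have hsub : ({↑u, ↑v, ↑w} : Set (OnePoint ℂ)) ⊆ I := by
      rintro z (rfl | rfl | rfl) <;> exact hmem (by simp [polyE])
    rw [show ({↑u, ↑v, ↑w, OnePoint.infty} : Set (OnePoint ℂ)) =
        {↑u, ↑v, ↑w} ∪ {OnePoint.infty} by simp only [Set.insert_union, Set.singleton_union],
      Set.inter_union_distrib_left, Set.inter_eq_self_of_subset_right hsub,
      Set.encard_union_eq (Set.disjoint_left.2 (by simp +contextual)),
      Set.encard_eq_three.2 ⟨_, _, _, by simpa, by simpa, by simpa, rfl⟩]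
  have hpair : (I ∩ {((0 : ℂ) : OnePoint ℂ), OnePoint.infty}).encard =
      (I ∩ {((0 : ℂ) : OnePoint ℂ)}).encard + (I ∩ {OnePoint.infty}).encard := by
    rw [Set.insert_eq, Set.inter_union_distrib_left,
      Set.encard_union_eq (Set.disjoint_left.2 (by simp +contextual))]
  rw [← encard_preimage_rho_add hu hv hw, huvw, hpair]
  ring

end Counting

end DoubleCover

end

theorem mainTheorem7 (u v w : ℂ) (hu : u ≠ 0) (hv : v ≠ 0) (hw : w ≠ 0)
    (huv : u ≠ v) (huw : u ≠ w) (hvw : v ≠ w)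
    (O : DoubleCover.Point (DoubleCover.polyE u v w) 1)
    (hO : O ∈ DoubleCover.Point.ramification (DoubleCover.polyE u v w) 1)
    (O' : DoubleCover.Point (DoubleCover.polyE' u v w) 1)
    (hO' : O' ∈ DoubleCover.Point.ramification (DoubleCover.polyE' u v w) 1) :
    (∀ T : Set (DoubleCover.Point (DoubleCover.polyC u v w) 2),
      DoubleCover.IsHyperellipticTorsionPacket T ↔
        T = DoubleCover.rho ⁻¹' DoubleCover.commonTorsion O O') ∧
    (∀ T : Set (DoubleCover.Point (DoubleCover.polyC u v w) 2),
      DoubleCover.IsHyperellipticTorsionPacket T →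
        T.encard + 6 + 2 * (DoubleCover.commonTorsion O O' ∩
            {((0 : ℂ) : OnePoint ℂ), OnePoint.infty}).encard =
          4 * (DoubleCover.commonTorsion O O').encard) := by
  have h (T : Set (DoubleCover.Point (DoubleCover.polyC u v w) 2)) :
      DoubleCover.IsHyperellipticTorsionPacket T ↔
        T = DoubleCover.rho ⁻¹' DoubleCover.commonTorsion O O' :=
    DoubleCover.isHyperellipticTorsionPacket_iff_eq_preimage_rho hu hv hw huv huw hvw hO hO'
  refine ⟨h, fun T hT => ?_⟩
  obtain rfl := (h T).1 hT
  exact DoubleCover.encard_preimage_rho_of_ramification_subset hu hv hw huv huw hvw hT.2
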